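/- **Setting.** Let $(\Omega,(\mathcal F_n)_n,\mathbb P)$ be a filtered probability space, $N\in\mathbb N$, $\emptyset\ne\mathcal N\subset\{1,\dots,N-1\}$, $Q,\delta t,\sigma,\gamma>0$, $S_0\in\mathbb R$. Let $L:\mathbb R\to\mathbb R_+$ be continuous, even, strictly convex, increasing on $\mathbb R_+$, with $L(0)=0$ and $L(\rho)/\rho\to+\infty$ as $\rho\to+\infty$; let $\ell:\mathbb R\to\mathbb R$ be convex, even, increasing on $\mathbb R_+$, with $\ell(0)=0$; let $f$ be nonnegative, nonincreasing on $(0,\infty)$ and integrable on $(0,x)$ for every $x>0$. Put $G(q)=\int_q^Q f(|Q-y|)\,dy$ and $F(q)=\int_q^Q y f(|Q-y|)\,dy$. The volumes $V_1,\dots,V_N>0$ are $\mathcal F_0$-measurable. The pairs $(\epsilon_k,\epsilon'_k)_{1\le k\le N}$ are identically distributed, $(\epsilon_{k},\epsilon'_{k})$ is $\mathcal F_{k}$-measurable and independent of $\mathcal F_{k-1}$; they have mean $0$, variances $1$, covariance $\sqrt3/2$, and $\mathbb E[e^{t\epsilon_1}]<\infty$, $\mathbb E[e^{t\epsilon'_1}]<\infty$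 for $t\ge0$. For $0\le n\le N$, $\mathcal A_n$ is the set of pairs $(v,n^\star)$ of an adapted real process $v=(v_k)_{n\le k<n^\star}$ and a stopping time $n^\star$ with values in $(\mathcal N\cup\{N\})\cap\{n,\dots,N\}$. Given $(v,n^\star)\in\mathcal A_n$ and a state $(x,q,S,A)$ at time $n$, put $q_n=q$, $S_n=S$, $X_n=x$, $A_n=A$ and $$q_{k+1}=q_k-v_k\delta t,\qquad S_{k+1}=S_k+\sigma\sqrt{\delta t}\,\epsilon_{k+1}+G(q_{k+1})-G(q_k),\qquad A_{k+1}=\tfrac{k}{k+1}A_k+\tfrac1{k+1}S_{k+1},$$ $$X_{k+1}=X_k+v_kS_{k+1}\delta t-q_k\big(G(q_{k+1})-G(q_k)\big)+F(q_{k+1})-F(q_k)+L\Big(\frac{v_k}{V_{k+1}}\Big)V_{k+1}\delta t-\frac{\sigma v_k\delta t^{3/2}}{\sqrt3}\epsilon'_{k+1},$$ and $Z_k=\frac{S_k-A_k}{\sigma\sqrt{\delta t}}$ for $k\ge1$. Let $$u_n(x,q,S,A)=\sup_{(v,n^\star)\in\mathcal A_n}\mathbb E\Big[-\exp\Big(-\gamma\big(QA_{n^\star}-X_{n^\star}-q_{n^\star}S_{n^\star}-F(0)+F(q_{n^\star})-\ell(q_{n^\star})\big)\Big)\Big]\in[-\infty,0].$$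 For $n=0$ this does not depend on $A$; the bank's problem at inception is the one for $n=0$ and $(x,q,S)=(0,Q,S_0)$. A strategy in $\mathcal A_n$ is *optimal* from $(x,q,S,A)$ if it attains this supremum. For $1\le n<N$ put $$J_n(q,Z,v)=\frac1\gamma\log\mathbb E\Big[\exp\Big(\gamma\Big(\sigma\sqrt{\delta t}\big((q-\tfrac{Q}{n+1})\epsilon_{n+1}-\tfrac{Q}{n+1}Z\big)-\tfrac{\sigma v\delta t^{3/2}}{\sqrt3}\epsilon'_{n+1}-\tfrac{Q}{n+1}\big(G(q-v\delta t)-G(q)\big)$$ $$\qquad+L\big(\tfrac{v}{V_{n+1}}\big)V_{n+1}\delta t+\theta_{n+1}\Big(q-v\delta t,\tfrac{n}{n+1}\Big(Z+\epsilon_{n+1}+\tfrac{G(q-v\delta t)-G(q)}{\sigma\sqrt{\delta t}}\Big)\Big)\Big)\Big)\Big],\qquad\tilde\theta_{n,n+1}(q,Z)=\inf_{v\in\mathbb R}J_n(q,Z,v),$$ where $\theta_N(q,Z)=\ell(q)+F(0)$, $\theta_n=\min\{\tilde\theta_{n,n+1},\ell+F(0)\}$ if $n\in\mathcal N$, and $\theta_n=\tilde\theta_{n,n+1}$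 if $n\notin\mathcal N$, $1\le n<N$. Let also $$J_0(v)=\frac1\gamma h\Big(-\gamma\frac{v\delta t}{\sqrt3}\Big)-Q\big(G(Q-v\delta t)-G(Q)\big)+L\Big(\frac{v}{V_1}\Big)V_1\delta t+\theta_1(Q-v\delta t,0),$$ where $h(z)=\log\mathbb E[\exp(z\sigma\sqrt{\delta t}\,\epsilon'_1)]$. In $J_n$, $\tilde\theta_{n,n+1}$, $\theta_n$, $J_0$ the volumes, known at time $0$, are treated as parameters (the expectations are over $\epsilon_{n+1},\epsilon'_{n+1}$ only) and are then given their realised values; all these functions take values in $[-\infty,+\infty]$. Consider the following **rule at the dates $1\le n<N$**, if the bank has not yet delivered: * if $n\notin\mathcal N$, send an order of size $v^*\delta t$ with $v^*\in\operatorname{argmin}_{v\in\mathbb R}J_n(q_n,Z_n,v)$; * if $n\in\mathcal N$ and $\tilde\theta_{n,n+1}(q_n,Z_n)<\ell(q_n)+F(0)$, do not deliver and send an order of size $v^*\delta t$ with $v^*\in\operatorname{argmin}_{v\in\mathbb R}J_n(q_n,Z_n,v)$; * if $n\in\mathcal N$ and $\ell(q_n)+F(0)\le\tilde\theta_{n,n+1}(q_n,Z_n)$,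 deliver. **Proposition (optimal strategy with permanent impact).** 1. For all positive values of the volumes, the functions $J_0$ and $J_n(q,Z,\cdot)$, $1\le n<N$, $q,Z\in\mathbb R$, have minimisers. 2. There are strategies in $\mathcal A_0$ which, almost surely, send at time $0$ an order of size $v^*\delta t$ with $v^*\in\operatorname{argmin}_{v\in\mathbb R}J_0(v)$ and then follow the rule at the dates $1\le n<N$; every such strategy is optimal for the problem at inception. 3. For every $1\le n<N$ and every state $(x,q,S,A)\in\mathbb R^4$ at time $n$, there are strategies in $\mathcal A_n$ which, almost surely, follow the rule at the dates $n,\dots,N-1$; every such strategy is optimal from $(x,q,S,A)$. -/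

import Mathlib

open MeasureTheory ProbabilityTheory Filter Topology
open scoped ENNReal

namespace ASR

/-- The data of the discrete-time model of an accelerated share repurchase with permanent and
temporary market impact. `V`, `ε`, `ε'` are indexed from `1` to `N`. -/
structure Model (Ω : Type*) where
  /-- number of days -/
  N : ℕ
  /-- the dates, before the last one, at which the bank may choose to deliver -/
  deliveryDates : Set ℕ
  /-- number of shares to be bought -/
  Q : ℝ
  /-- length of a day -/
  δt : ℝ
  /-- volatility -/
  σ : ℝ
  /-- absolute risk aversion -/
  γ : ℝ
  /-- initial price -/
  S₀ : ℝ
  /-- execution cost function -/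
  L : ℝ → ℝ
  /-- penalty at delivery -/
  ell : ℝ → ℝ
  /-- permanent impact function -/
  f : ℝ → ℝ
  /-- market volumes -/
  V : ℕ → Ω → ℝ
  /-- price innovations -/
  ε : ℕ → Ω → ℝ
  /-- innovations due to the execution being spread over the day -/
  ε' : ℕ → Ω → ℝ

namespace Model

variable {Ω : Type*}

/-- The standing assumptions. `f` is only constrained on `(0, ∞)`, so that it may have an
integrable singularity at `0`; "increasing" and "decreasing" are meant in the wide sense. The
pairs `(ε k, ε' k)` are i.i.d.: each is independent of the past and they have the same law. -/
structure Standing [mΩ : MeasurableSpace Ω] (M : Model Ω) (ℱ : Filtration ℕ mΩ)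
    (P : Measure Ω) : Prop where
  Q_pos : 0 < M.Q
  δt_pos : 0 < M.δt
  σ_pos : 0 < M.σ
  γ_pos : 0 < M.γ
  dates_nonempty : M.deliveryDates.Nonempty
  dates_mem : ∀ n ∈ M.deliveryDates, 1 ≤ n ∧ n + 1 ≤ M.N
  -- temporary impact
  L_continuous : Continuous M.L
  L_nonneg : ∀ ρ, 0 ≤ M.L ρ
  L_zero : M.L 0 = 0
  L_even : ∀ ρ, M.L (-ρ) = M.L ρ
  L_mono : MonotoneOn M.L (Set.Ici 0)
  L_convex : StrictConvexOn ℝ Set.univ M.L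
  L_superlinear : Tendsto (fun ρ => M.L ρ / ρ) atTop atTop
  -- penalty at delivery
  ell_zero : M.ell 0 = 0
  ell_even : ∀ q, M.ell (-q) = M.ell q
  ell_mono : MonotoneOn M.ell (Set.Ici 0)
  ell_convex : ConvexOn ℝ Set.univ M.ell
  -- permanent impact
  f_nonneg : ∀ x, 0 < x → 0 ≤ M.f x
  f_anti : AntitoneOn M.f (Set.Ioi 0)
  f_integrable : ∀ x, 0 < x → IntervalIntegrable M.f volume 0 x
  -- market volumes, known at time `0`
  V_measurable : ∀ k, 1 ≤ k → k ≤ M.N → Measurable[ℱ 0] (M.V k)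
  V_pos : ∀ k, 1 ≤ k → k ≤ M.N → ∀ ω, 0 < M.V k ω
  -- innovations
  ε_measurable : ∀ k, 1 ≤ k → k ≤ M.N → Measurable[ℱ k] (M.ε k)
  ε'_measurable : ∀ k, 1 ≤ k → k ≤ M.N → Measurable[ℱ k] (M.ε' k)
  indep : ∀ k, k < M.N →
    Indep (MeasurableSpace.comap (fun ω => (M.ε (k + 1) ω, M.ε' (k + 1) ω)) inferInstance)
      (ℱ k) P
  ident : ∀ k, 1 ≤ k → k ≤ M.N →
    IdentDistrib (fun ω => (M.ε k ω, M.ε' k ω)) (fun ω => (M.ε 1 ω, M.ε' 1 ω)) P P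
  ε_memLp : MemLp (M.ε 1) 2 P
  ε'_memLp : MemLp (M.ε' 1) 2 P
  ε_mean : ∫ ω, M.ε 1 ω ∂P = 0
  ε'_mean : ∫ ω, M.ε' 1 ω ∂P = 0
  ε_var : variance (M.ε 1) P = 1
  ε'_var : variance (M.ε' 1) P = 1
  ε_cov : covariance (M.ε 1) (M.ε' 1) P = √3 / 2
  ε_mgf : ∀ t : ℝ, 0 ≤ t → Integrable (fun ω => Real.exp (t * M.ε 1 ω)) P
  ε'_mgf : ∀ t : ℝ, 0 ≤ t → Integrable (fun ω => Real.exp (t * M.ε' 1 ω)) P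

noncomputable section

variable (M : Model Ω)

/-! ### Permanent impact -/

/-- `G(q) = ∫_q^Q f(|Q - y|) dy`. -/
def G (q : ℝ) : ℝ := ∫ y in q..M.Q, M.f |M.Q - y|

/-- `F(q) = ∫_q^Q y f(|Q - y|) dy`. -/
def F (q : ℝ) : ℝ := ∫ y in q..M.Q, y * M.f |M.Q - y|

/-! ### State variables, started at time `n` from `(x, q, S, A)` -/

/-- Shares remaining to be bought at time `k`. -/
def inventory (v : ℕ → Ω → ℝ) (n : ℕ) (q : ℝ) (k : ℕ) (ω : Ω) : ℝ :=
  q - ∑ j ∈ Finset.Ico n k, v j ω * M.δt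

/-- Price at time `k`. -/
def price (v : ℕ → Ω → ℝ) (n : ℕ) (q S : ℝ) (k : ℕ) (ω : Ω) : ℝ :=
  S + (M.G (M.inventory v n q k ω) - M.G q)
    + M.σ * √M.δt * ∑ j ∈ Finset.Ico n k, M.ε (j + 1) ω

/-- Average at time `k ≥ 1` of the prices since inception. For `n = 0` it does not depend
on `A`. -/
def average (v : ℕ → Ω → ℝ) (n : ℕ) (q S A : ℝ) (k : ℕ) (ω : Ω) : ℝ :=
  (n : ℝ) / k * A + 1 / (k : ℝ) * ∑ j ∈ Finset.Ico n k, M.price v n q S (j + 1) ω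

/-- Cash spent at time `k`. -/
def cash (v : ℕ → Ω → ℝ) (n : ℕ) (x q S : ℝ) (k : ℕ) (ω : Ω) : ℝ :=
  x + ∑ j ∈ Finset.Ico n k,
    (v j ω * M.price v n q S (j + 1) ω * M.δt
      - M.inventory v n q j ω
          * (M.G (M.inventory v n q (j + 1) ω) - M.G (M.inventory v n q j ω))
      + (M.F (M.inventory v n q (j + 1) ω) - M.F (M.inventory v n q j ω))
      + M.L (v j ω / M.V (j + 1) ω) * M.V (j + 1) ω * M.δt
      - M.σ * v j ω * M.δt ^ (3 / 2 : ℝ) / √3 * M.ε' (j + 1) ω)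

/-- The normalised spread `Z_k = (S_k - A_k) / (σ √δt)`, for `k ≥ 1`. -/
def spread (v : ℕ → Ω → ℝ) (n : ℕ) (q S A : ℝ) (k : ℕ) (ω : Ω) : ℝ :=
  (M.price v n q S k ω - M.average v n q S A k ω) / (M.σ * √M.δt)

/-! ### The optimisation problem -/

/-- A strategy: the trading rates `v` (irrelevant from the delivery time on), and the delivery
time. -/
abbrev Strategy (Ω : Type*) : Type _ := (ℕ → Ω → ℝ) × (Ω → ℕ)

/-- The set `𝒜_n` of admissible strategies at time `n`. -/
def admissible [mΩ : MeasurableSpace Ω] (ℱ : Filtration ℕ mΩ) (n : ℕ) : Set (Strategy Ω) :=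
  {s | (∀ k, n ≤ k → k < M.N → Measurable[ℱ k] (s.1 k)) ∧
    IsStoppingTime ℱ (fun ω => (s.2 ω : WithTop ℕ)) ∧
    ∀ ω, n ≤ s.2 ω ∧ (s.2 ω ∈ M.deliveryDates ∨ s.2 ω = M.N)}

/-- Final wealth of the bank, if it delivers at time `k`:
`Q A_k - X_k - q_k S_k - F(0) + F(q_k) - ℓ(q_k)`. -/
def wealth (v : ℕ → Ω → ℝ) (n : ℕ) (x q S A : ℝ) (k : ℕ) (ω : Ω) : ℝ :=
  M.Q * M.average v n q S A k ω - M.cash v n x q S k ω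
    - M.inventory v n q k ω * M.price v n q S k ω
    - M.F 0 + M.F (M.inventory v n q k ω) - M.ell (M.inventory v n q k ω)

/-- Expected utility `𝔼[-exp(-γ W)] ∈ [-∞, 0]` of a strategy `(v, n⋆)`, where `W` is the final
wealth. -/
def expectedUtility [MeasurableSpace Ω] (P : Measure Ω) (n : ℕ) (x q S A : ℝ)
    (s : Strategy Ω) : EReal :=
  -((∫⁻ ω, ENNReal.ofReal (Real.exp (-M.γ * M.wealth s.1 n x q S A (s.2 ω) ω)) ∂P : ℝ≥0∞) :
    EReal)

/-- The value function `u_n(x, q, S, A)`. -/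
def value [mΩ : MeasurableSpace Ω] (ℱ : Filtration ℕ mΩ) (P : Measure Ω)
    (n : ℕ) (x q S A : ℝ) : EReal :=
  ⨆ s ∈ M.admissible ℱ n, M.expectedUtility P n x q S A s

/-- An admissible strategy which attains the value `u_n(x, q, S, A)`. -/
def IsOptimal [mΩ : MeasurableSpace Ω] (ℱ : Filtration ℕ mΩ) (P : Measure Ω)
    (n : ℕ) (x q S A : ℝ) (s : Strategy Ω) : Prop :=
  s ∈ M.admissible ℱ n ∧ M.expectedUtility P n x q S A s = M.value ℱ P n x q S A

/-! ### The functions `θ_n` and `θ̃_{n,n+1}`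

They take values in `[-∞, +∞]`, and depend on the volumes `w = (w_k)_k`, to be replaced by the
volumes `(V_k)_k`, which are known at time `0`. -/

/-- `ℓ(q) + F(0)`. -/
def deliveryCost (q : ℝ) : ℝ := M.ell q + M.F 0

/-- `(1/γ) log 𝔼[exp(γ Y)]`. -/
def entropic [MeasurableSpace Ω] (P : Measure Ω) (Y : Ω → EReal) : EReal :=
  ((1 / M.γ : ℝ) : EReal) * ENNReal.log (∫⁻ ω, EReal.exp ((M.γ : EReal) * Y ω) ∂P)

/-- The one-step functional at time `n`, as a function of the trading rate `v`, when the
continuation cost at time `n + 1` is `θnext`. -/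
def stepFunctional [MeasurableSpace Ω] (P : Measure Ω) (w : ℕ → ℝ) (n : ℕ)
    (θnext : ℝ → ℝ → EReal) (q Z v : ℝ) : EReal :=
  M.entropic P fun ω =>
    ((M.σ * √M.δt * ((q - M.Q / (n + 1)) * M.ε (n + 1) ω - M.Q / (n + 1) * Z)
      - M.σ * v * M.δt ^ (3 / 2 : ℝ) / √3 * M.ε' (n + 1) ω
      - M.Q / (n + 1) * (M.G (q - v * M.δt) - M.G q)
      + M.L (v / w (n + 1)) * w (n + 1) * M.δt : ℝ) : EReal)
    + θnext (q - v * M.δt)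
        ((n : ℝ) / (n + 1)
          * (Z + M.ε (n + 1) ω + (M.G (q - v * M.δt) - M.G q) / (M.σ * √M.δt)))

open Classical in
/-- The functions `θ_n`, by backward induction from `θ_N(q, Z) = ℓ(q) + F(0)`. -/
def theta [MeasurableSpace Ω] (P : Measure Ω) (w : ℕ → ℝ) (n : ℕ) : ℝ → ℝ → EReal :=
  if M.N ≤ n then fun q _ => (M.deliveryCost q : EReal)
  else if n ∈ M.deliveryDates then fun q Z =>
    min (⨅ v : ℝ, M.stepFunctional P w n (theta P w (n + 1)) q Z v) (M.deliveryCost q : EReal)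
  else fun q Z => ⨅ v : ℝ, M.stepFunctional P w n (theta P w (n + 1)) q Z v
termination_by M.N - n

/-- The functional minimised at time `n` by the trading rate. -/
def objective [MeasurableSpace Ω] (P : Measure Ω) (w : ℕ → ℝ) (n : ℕ) (q Z v : ℝ) : EReal :=
  M.stepFunctional P w n (M.theta P w (n + 1)) q Z v

/-- `θ̃_{n,n+1}(q, Z)`. -/
def thetaTilde [MeasurableSpace Ω] (P : Measure Ω) (w : ℕ → ℝ) (n : ℕ) (q Z : ℝ) : EReal :=
  ⨅ v : ℝ, M.objective P w n q Z v

theorem theta_terminal [MeasurableSpace Ω] (P : Measure Ω) (w : ℕ → ℝ) (q Z : ℝ) :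
    M.theta P w M.N q Z = (M.deliveryCost q : EReal) := by
  rw [theta, if_pos le_rfl]

theorem theta_of_mem [MeasurableSpace Ω] (P : Measure Ω) (w : ℕ → ℝ) {n : ℕ} (hn : n < M.N)
    (h : n ∈ M.deliveryDates) (q Z : ℝ) :
    M.theta P w n q Z = min (M.thetaTilde P w n q Z) (M.deliveryCost q : EReal) := by
  rw [theta, if_neg (not_le.2 hn), if_pos h]
  rfl

theorem theta_of_notMem [MeasurableSpace Ω] (P : Measure Ω) (w : ℕ → ℝ) {n : ℕ} (hn : n < M.N)
    (h : n ∉ M.deliveryDates) (q Z : ℝ) :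
    M.theta P w n q Z = M.thetaTilde P w n q Z := by
  rw [theta, if_neg (not_le.2 hn), if_neg h]
  rfl

/-- The cumulant-generating function `h` of `σ √δt ε'_1`, with values in `[-∞, +∞]`. -/
def h [MeasurableSpace Ω] (P : Measure Ω) (z : ℝ) : EReal :=
  ENNReal.log (∫⁻ ω, ENNReal.ofReal (Real.exp (z * (M.σ * √M.δt * M.ε' 1 ω))) ∂P)

theorem h_eq_cgf [MeasurableSpace Ω] (P : Measure Ω) [IsProbabilityMeasure P] (z : ℝ)
    (hz : Integrable (fun ω => Real.exp (z * (M.σ * √M.δt * M.ε' 1 ω))) P) :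
    M.h P z = (cgf (fun ω => M.σ * √M.δt * M.ε' 1 ω) P z : EReal) := by
  rw [h, ← ofReal_integral_eq_lintegral_ofReal hz (ae_of_all _ fun ω => (Real.exp_pos _).le)]
  exact ENNReal.log_ofReal_of_pos (mgf_pos hz)

/-- The functional minimised at time `0` by the trading rate; its infimum is the indifference
price of the contract. -/
def priceFunctional [MeasurableSpace Ω] (P : Measure Ω) (w : ℕ → ℝ) (v : ℝ) : EReal :=
  ((1 / M.γ : ℝ) : EReal) * M.h P (-M.γ * (v * M.δt / √3))
    + ((-M.Q * (M.G (M.Q - v * M.δt) - M.G M.Q) + M.L (v / w 1) * w 1 * M.δt : ℝ) : EReal)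
    + M.theta P w 1 (M.Q - v * M.δt) 0

/-! ### The decision rule -/

/-- The set of minimisers of a function of the trading rate. -/
def argmin (J : ℝ → EReal) : Set ℝ := {v | ∀ v', J v ≤ J v'}

/-- The path of market volumes. -/
def volumes (ω : Ω) : ℕ → ℝ := fun k => M.V k ω

/-- At time `0`, the order minimises the price functional. -/
def FollowsInitialRule [MeasurableSpace Ω] (P : Measure Ω) (s : Strategy Ω) : Prop :=
  ∀ᵐ ω ∂P, s.1 0 ω ∈ argmin (M.priceFunctional P (M.volumes ω))

/-- The rule at the dates `k ≥ 1`, for the problem started at time `n` from `(q, S, A)`. If the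
bank has not delivered before the date `k`:
* if `k` is not a possible delivery date, or if `θ̃_{k,k+1}(q_k, Z_k) < ℓ(q_k) + F(0)`, it goes
  on, with an order minimising the one-step functional;
* if `k` is a possible delivery date and `ℓ(q_k) + F(0) ≤ θ̃_{k,k+1}(q_k, Z_k)`, it delivers. -/
def FollowsRule [MeasurableSpace Ω] (P : Measure Ω) (n : ℕ) (q S A : ℝ)
    (s : Strategy Ω) : Prop :=
  ∀ᵐ ω ∂P, ∀ k, 1 ≤ k → n ≤ k → k < M.N → k ≤ s.2 ω →
    let qk := M.inventory s.1 n q k ω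
    let Zk := M.spread s.1 n q S A k ω
    let w := M.volumes ω
    (k ∉ M.deliveryDates → k < s.2 ω ∧ s.1 k ω ∈ argmin (M.objective P w k qk Zk)) ∧
    (k ∈ M.deliveryDates → M.thetaTilde P w k qk Zk < (M.deliveryCost qk : EReal) →
      k < s.2 ω ∧ s.1 k ω ∈ argmin (M.objective P w k qk Zk)) ∧
    (k ∈ M.deliveryDates → (M.deliveryCost qk : EReal) ≤ M.thetaTilde P w k qk Zk →
      s.2 ω = k)

end

end Model

end ASR

/-! Everything is transported to `[0, ∞]` by `y ↦ exp(γ y)` (`expScale`), an order isomorphism which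
turns `entropic` into a plain integral, sums into products and infima into infima. Infinite values
then need no separate treatment.

Optimality is a verification argument. The wealth gross of the delivery cost (`gain`) drops each day
by a running cost depending only on volumes, inventory, normalised spread, order and new innovations
(`gain_succ`), and the spread is updated from the same data (`spread_succ`). Hence (volumes,
inventory, spread) is a sufficient state. `stagedCost` replaces, on the event of no delivery before
`k`, the final cost by `exp(-γ gain_k) exp(γ θ_k)`. By Bellman's inequality it is nondecreasing in
`k` for every strategy, and it is also nonincreasing under the rule. At `k = N` it is the expected
cost of the strategy; at the starting date it is the same for all strategies. This sandwich gives
`isOptimal_of_decidesOptimally`.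

Existence rests on coercivity. `L` is superlinear, whereas the rest of the running cost, on an event
where the innovations are bounded, is at most linear in the state and the order; in particular `G`
has linear growth because `f ≤ f 1` beyond `1`. Together with an exponential lower bound on `exp(γ
θ_{n+1})` this makes the objective coercive in `v`, locally uniformly in the state
(`expObjective_ge`). Fatou's lemma gives joint lower semicontinuity, coercivity passes it on to the
infimum, and a backward induction closes (`expTheta_regular`). Minimisers can then be selected
measurably; feeding them back into the dynamics and stopping on first entrance into the delivery
region produces a strategy that follows the rule.

Date `0` is the same objective at `n = 0`, which agrees with `exp(γ J_0)` up to a constant factor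
(`expObjective_zero`). -/

namespace ASR

/-! ### Lower semicontinuity, and selection of minimisers -/

section Semicontinuity

variable {X : Type*} [TopologicalSpace X]

/-- Fatou's lemma: first countability turns a failure of semicontinuity into a sequence along which
the integrals stay below `y`. -/
theorem lowerSemicontinuous_lintegral [FirstCountableTopology X] {Ω : Type*} [MeasurableSpace Ω]
    (P : Measure Ω) {g : X → Ω → ℝ≥0∞} (hg : ∀ ω, LowerSemicontinuous fun x => g x ω)
    (hm : ∀ x, Measurable (g x)) : LowerSemicontinuous fun x => ∫⁻ ω, g x ω ∂P := by
  intro x₀ y hy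
  by_contra hcon
  obtain ⟨u, hu, hu'⟩ := exists_seq_forall_of_frequently (not_eventually.1 hcon)
  have h₁ : ∫⁻ ω, g x₀ ω ∂P ≤ ∫⁻ ω, liminf (fun n => g (u n) ω) atTop ∂P := by
    refine lintegral_mono fun ω => le_of_forall_lt fun c hc => ?_
    obtain ⟨d, hcd, hd⟩ := exists_between hc
    refine hcd.trans_le (le_liminf_of_le (by isBoundedDefault) ?_)
    filter_upwards [hu.eventually (hg ω x₀ d hd)] with n hn using hn.le
  have h₂ : ∫⁻ ω, liminf (fun n => g (u n) ω) atTop ∂P ≤ y := by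
    refine (lintegral_liminf_le fun n => hm (u n)).trans ?_
    refine (liminf_le_liminf (Eventually.of_forall fun n => not_lt.1 (hu' n))).trans ?_
    simp
  exact absurd (h₁.trans h₂) (not_le.2 hy)

/-- Multiplication on `[0, ∞]` is not continuous at `(0, ∞)`; here the continuous factor is positive
and finite, so one can divide by it. -/
theorem LowerSemicontinuous.ofReal_exp_mul {r : X → ℝ} (hr : Continuous r) {g : X → ℝ≥0∞}
    (hg : LowerSemicontinuous g) :
    LowerSemicontinuous fun x => ENNReal.ofReal (Real.exp (r x)) * g x := by
  intro x₀ y hy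
  have hpos : ∀ x, ENNReal.ofReal (Real.exp (r x)) ≠ 0 := fun x => by
    simpa using Real.exp_pos _
  have h₁ : y / ENNReal.ofReal (Real.exp (r x₀)) < g x₀ :=
    (ENNReal.div_lt_iff (Or.inl (hpos _)) (Or.inl ENNReal.ofReal_ne_top)).2 (by rwa [mul_comm])
  obtain ⟨b, hb, hb'⟩ := exists_between h₁
  have h₂ : y < ENNReal.ofReal (Real.exp (r x₀)) * b := by
    rw [mul_comm]
    exact (ENNReal.div_lt_iff (Or.inl (hpos _)) (Or.inl ENNReal.ofReal_ne_top)).1 hb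
  have h₃ : Continuous fun x => ENNReal.ofReal (Real.exp (r x)) * b :=
    (ENNReal.continuous_mul_const (ne_top_of_lt hb')).comp
      (ENNReal.continuous_ofReal.comp (Real.continuous_exp.comp hr))
  filter_upwards [h₃.continuousAt.eventually (lt_mem_nhds h₂), hg x₀ b hb'] with x h h'
  exact h.trans_le (by gcongr)

/-- Tube lemma: a strict lower bound at every point of `{x₀} × K` persists on a neighbourhood of
`x₀`, uniformly over `K`. -/
theorem lowerSemicontinuous_iInf_of_isCompact {J : X → ℝ → ℝ≥0∞}
    (hJ : LowerSemicontinuous fun p : X × ℝ => J p.1 p.2) {K : Set ℝ} (hK : IsCompact K) :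
    LowerSemicontinuous fun x => ⨅ v ∈ K, J x v := by
  intro x₀ y hy
  obtain ⟨c, hc, hc'⟩ := exists_between hy
  have : ∀ᶠ x in 𝓝 x₀, ∀ v ∈ K, c < J x v :=
    hK.eventually_forall_of_forall_eventually fun v hv =>
      hJ (x₀, v) c (hc'.trans_le (iInf₂_le v hv))
  filter_upwards [this] with x hx
  exact hc.trans_le (le_iInf₂ fun v hv => (hx v hv).le)

/-- Local uniform growth at infinity of a functional depending on a parameter. -/
def LocallyCoercive (J : X → ℝ → ℝ≥0∞) : Prop :=
  ∀ x₀, ∃ C : ℝ, ∀ᶠ x in 𝓝 x₀, ∀ v, ENNReal.ofReal (Real.exp (|v| - C)) ≤ J x v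

variable {J : X → ℝ → ℝ≥0∞}

theorem LocallyCoercive.exists_radius (hc : LocallyCoercive J) (x₀ : X) {y : ℝ≥0∞}
    (hy : y ≠ ∞) : ∃ R : ℝ, ∀ᶠ x in 𝓝 x₀, ∀ v, v ∉ Set.Icc (-R) R → y < J x v := by
  obtain ⟨C, hC⟩ := hc x₀
  -- Outside this radius `|v| - C > y`, and `exp t ≥ t + 1` suffices.
  refine ⟨y.toReal + C, hC.mono fun x hx v hv => lt_of_lt_of_le ?_ (hx v)⟩
  rw [ENNReal.lt_ofReal_iff_toReal_lt hy]
  have : y.toReal + C < |v| := by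
    by_contra h
    exact hv (abs_le.1 (not_lt.1 h))
  linarith [Real.add_one_le_exp (|v| - C)]

/-- Locally in `x`, orders outside a fixed compact interval cost more than the level under test, so
the compact case applies. -/
theorem LocallyCoercive.lowerSemicontinuous_iInf (hc : LocallyCoercive J)
    (hJ : LowerSemicontinuous fun p : X × ℝ => J p.1 p.2) :
    LowerSemicontinuous fun x => ⨅ v, J x v := by
  intro x₀ y hy
  obtain ⟨c, hyc, hc'⟩ := exists_between hy
  obtain ⟨R, hR⟩ := hc.exists_radius x₀ (ne_top_of_lt hc')
  have h₁ := lowerSemicontinuous_iInf_of_isCompact hJ (isCompact_Icc (a := -R) (b := R)) x₀ c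
    (hc'.trans_le (le_iInf₂ fun v _ => iInf_le _ v))
  filter_upwards [hR, h₁] with x hx hx'
  refine hyc.trans_le (le_iInf fun v => ?_)
  by_cases hv : v ∈ Set.Icc (-R) R
  · exact hx'.le.trans (iInf₂_le v hv)
  · exact (hx v hv).le

theorem lowerSemicontinuous_section (hJ : LowerSemicontinuous fun p : X × ℝ => J p.1 p.2)
    (x : X) : LowerSemicontinuous (J x) :=
  hJ.comp (continuous_const.prodMk continuous_id)

theorem LocallyCoercive.exists_minimiser (hc : LocallyCoercive J)
    (hJ : LowerSemicontinuous fun p : X × ℝ => J p.1 p.2) (x : X) :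
    ∃ v, J x v ≤ ⨅ v', J x v' := by
  by_cases htop : ⨅ v', J x v' = ∞
  -- If the infimum is infinite, every point is a minimiser.
  · exact ⟨0, by simp [htop]⟩
  obtain ⟨c, hc₁, hc₂⟩ := exists_between (lt_top_iff_ne_top.2 htop)
  obtain ⟨R, hR⟩ := hc.exists_radius x hc₂.ne
  obtain ⟨v₀, hv₀⟩ := iInf_lt_iff.1 hc₁
  have hmem : v₀ ∈ Set.Icc (-R) R := by
    by_contra h
    exact lt_asymm hv₀ (hR.self_of_nhds v₀ h)
  obtain ⟨v, -, hv⟩ := LowerSemicontinuousOn.exists_isMinOn ⟨v₀, hmem⟩ isCompact_Icc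
    ((lowerSemicontinuous_section hJ x).lowerSemicontinuousOn _)
  refine ⟨v, le_iInf fun v' => ?_⟩
  by_cases hv' : v' ∈ Set.Icc (-R) R
  · exact hv hv'
  · exact (hv hmem).trans (hv₀.le.trans (hR.self_of_nhds v' hv').le)

/-- A locally coercive normal integrand has a measurable selection of minimisers. -/
theorem LocallyCoercive.exists_measurable_minimiser [MeasurableSpace X] [OpensMeasurableSpace X]
    [SecondCountableTopology X] (hc : LocallyCoercive J)
    (hJ : LowerSemicontinuous fun p : X × ℝ => J p.1 p.2) :
    ∃ φ : X → ℝ, Measurable φ ∧ ∀ x, J x (φ x) ≤ ⨅ v, J x v := by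
  -- `r x` is the least absolute value of a minimiser; it is attained because the minimisers form a
  -- closed set. The selection is `r x` if that is a minimiser, and `-r x` otherwise.
  have hex : ∀ x, ∃ r, 0 ≤ r ∧ (J x r ≤ (⨅ v, J x v) ∨ J x (-r) ≤ ⨅ v, J x v) ∧
      ∀ v, J x v ≤ (⨅ v, J x v) → r ≤ |v| := by
    intro x
    obtain ⟨v₀, hv₀⟩ := hc.exists_minimiser hJ x
    have hclosed : IsClosed {v | J x v ≤ ⨅ v, J x v} :=
      (lowerSemicontinuous_section hJ x).isClosed_preimage _
    have hcpt : IsCompact ({v | J x v ≤ ⨅ v, J x v} ∩ Set.Icc (-|v₀|) |v₀|) :=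
      isCompact_Icc.inter_left hclosed
    obtain ⟨v₁, hv₁, hmin⟩ := hcpt.exists_isMinOn ⟨v₀, hv₀, neg_abs_le _, le_abs_self _⟩
      continuous_abs.continuousOn
    refine ⟨|v₁|, abs_nonneg _, ?_, fun v hv => ?_⟩
    · rcases abs_choice v₁ with h | h
      · left; rw [h]; exact hv₁.1
      · right; rw [h, neg_neg]; exact hv₁.1
    · rcases le_total |v| |v₀| with h | h
      · exact hmin ⟨hv, abs_le.1 h⟩
      · exact (abs_le.2 hv₁.2).trans h
  choose r hr₀ hr hrmin using hex
  have hm : Measurable fun x => ⨅ v, J x v := (hc.lowerSemicontinuous_iInf hJ).measurable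
  have hrm : Measurable r := by
    refine measurable_of_Iic fun c => ?_
    -- `r x ≤ c` means that the minimum over `[-c, c]` is already the global one; both minima are
    -- lower semicontinuous in `x`, hence measurable.
    have : r ⁻¹' Set.Iic c = {x | 0 ≤ c ∧ (⨅ v ∈ Set.Icc (-c) c, J x v) ≤ ⨅ v, J x v} := by
      ext x
      simp only [Set.mem_preimage, Set.mem_Iic, Set.mem_ofPred_eq]
      constructor
      · intro h
        refine ⟨(hr₀ x).trans h, ?_⟩
        rcases hr x with h' | h'
        · exact (iInf₂_le (r x) ⟨by linarith [hr₀ x], h⟩).trans h'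
        · exact (iInf₂_le (-r x) ⟨by linarith [hr₀ x], by linarith [hr₀ x]⟩).trans h'
      · rintro ⟨h0, h⟩
        obtain ⟨v, hv, hmin⟩ := LowerSemicontinuousOn.exists_isMinOn (s := Set.Icc (-c) c)
          ⟨0, by simpa using h0, h0⟩ isCompact_Icc
          ((lowerSemicontinuous_section hJ x).lowerSemicontinuousOn _)
        exact (hrmin x v ((le_iInf₂ fun v' hv' => hmin hv').trans h)).trans (abs_le.2 hv)
    rw [this]
    exact (MeasurableSet.const _).inter (measurableSet_le
      (lowerSemicontinuous_iInf_of_isCompact hJ isCompact_Icc).measurable hm)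
  have hset : MeasurableSet {x | J x (r x) ≤ ⨅ v, J x v} :=
    measurableSet_le (hJ.measurable.comp (measurable_id.prodMk hrm)) hm
  classical
  refine ⟨fun x => if J x (r x) ≤ ⨅ v, J x v then r x else -r x,
    Measurable.ite hset hrm hrm.neg, fun x => ?_⟩
  dsimp only
  split_ifs with h
  · exact h
  · exact (hr x).resolve_left h

end Semicontinuity

/-! ### Integration with respect to independent noise -/

/-- Conditioning on `m` without conditional expectations: the joint law of `(Φ, Y)` and `ξ` is a
product, so Tonelli applies, infinite values included. -/
theorem lintegral_freeze {Ω : Type*} {m mΩ : MeasurableSpace Ω} {P : Measure Ω}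
    [IsProbabilityMeasure P] (hm : m ≤ mΩ) {E : Type*} [MeasurableSpace E]
    {Y : Ω → E} (hY : Measurable[m] Y) {ξ : Ω → ℝ × ℝ} (hξ : Measurable ξ)
    (hind : Indep (MeasurableSpace.comap ξ inferInstance) m P) {Φ : Ω → ℝ≥0∞}
    (hΦ : Measurable[m] Φ) {g : E × (ℝ × ℝ) → ℝ≥0∞} (hg : Measurable g) :
    ∫⁻ ω, Φ ω * g (Y ω, ξ ω) ∂P = ∫⁻ ω, Φ ω * ∫⁻ ω', g (Y ω, ξ ω') ∂P ∂P := by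
  have hYm : Measurable[m] fun ω => (Φ ω, Y ω) := hΦ.prodMk hY
  have hYm' : Measurable fun ω => (Φ ω, Y ω) := hYm.mono hm le_rfl
  have hif : IndepFun (fun ω => (Φ ω, Y ω)) ξ P :=
    (indep_of_indep_of_le_right hind hYm.comap_le).symm
  have hmap := (indepFun_iff_map_prod_eq_prod_map_map hYm'.aemeasurable hξ.aemeasurable).1 hif
  have hg' : Measurable fun z : (ℝ≥0∞ × E) × (ℝ × ℝ) => z.1.1 * g (z.1.2, z.2) := by fun_prop
  have : IsProbabilityMeasure (P.map ξ) := Measure.isProbabilityMeasure_map hξ.aemeasurable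
  calc ∫⁻ ω, Φ ω * g (Y ω, ξ ω) ∂P
      = ∫⁻ z, z.1.1 * g (z.1.2, z.2) ∂(P.map fun ω => ((Φ ω, Y ω), ξ ω)) := by
        rw [lintegral_map hg' (hYm'.prodMk hξ)]
    _ = ∫⁻ ω, ∫⁻ ω', Φ ω * g (Y ω, ξ ω') ∂P ∂P := by
        rw [hmap, lintegral_prod _ hg'.aemeasurable, lintegral_map hg'.lintegral_prod_right' hYm']
        refine lintegral_congr fun ω => ?_
        rw [lintegral_map (by fun_prop) hξ]
    _ = _ := by
        refine lintegral_congr fun ω => ?_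
        rw [lintegral_const_mul]
        exact hg.comp (measurable_const.prodMk hξ)

/-- Any level below `1` would do; `exp (-1)` merges conveniently with the exponents of later
estimates. -/
theorem exists_bound_of_isProbabilityMeasure {Ω : Type*} [MeasurableSpace Ω] (P : Measure Ω)
    [IsProbabilityMeasure P] (X : Ω → ℝ) :
    ∃ K : ℝ, 0 ≤ K ∧ ENNReal.ofReal (Real.exp (-1)) ≤ P {ω | X ω ≤ K} := by
  have hmono : Monotone fun n : ℕ => {ω | X ω ≤ n} := fun a b hab ω (hω : X ω ≤ a) =>
    hω.trans (Nat.cast_le.2 hab)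
  have hunion : ⋃ n : ℕ, {ω | X ω ≤ n} = Set.univ := by
    ext ω
    simpa using exists_nat_ge (X ω)
  have ht := tendsto_measure_iUnion_atTop (μ := P) hmono
  rw [hunion, measure_univ] at ht
  have : ENNReal.ofReal (Real.exp (-1)) < 1 := by
    rw [← ENNReal.ofReal_one]
    exact (ENNReal.ofReal_lt_ofReal_iff one_pos).2 (Real.exp_lt_one_iff.2 (by norm_num))
  obtain ⟨n, hn⟩ := (ht.eventually (lt_mem_nhds this)).exists
  exact ⟨n, n.cast_nonneg, hn.le⟩

namespace Model

noncomputable section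

variable {Ω : Type*}

/-! ### Exponential change of scale -/

/-- `y ↦ exp(γ y)`, from `[-∞, +∞]` to `[0, +∞]`. -/
def expScale (M : Model Ω) (y : EReal) : ℝ≥0∞ := EReal.exp ((M.γ : EReal) * y)

section ExpScale

variable {M : Model Ω} (hγ : 0 < M.γ)
include hγ

theorem gamma_mul_inv_gamma_mul (y : EReal) :
    (M.γ : EReal) * (((1 / M.γ : ℝ) : EReal) * y) = y := by
  rw [← mul_assoc, ← EReal.coe_mul, mul_one_div_cancel hγ.ne', EReal.coe_one, one_mul]

theorem inv_gamma_mul_gamma_mul (y : EReal) :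
    ((1 / M.γ : ℝ) : EReal) * ((M.γ : EReal) * y) = y := by
  rw [← mul_assoc, ← EReal.coe_mul, one_div_mul_cancel hγ.ne', EReal.coe_one, one_mul]

theorem expScale_inv_gamma_log (x : ℝ≥0∞) :
    M.expScale (((1 / M.γ : ℝ) : EReal) * ENNReal.log x) = x := by
  rw [expScale, gamma_mul_inv_gamma_mul hγ, ENNReal.exp_log]

theorem expScale_strictMono : StrictMono M.expScale := by
  refine EReal.exp_strictMono.comp (Monotone.strictMono_of_injective (fun a b hab => ?_) ?_)
  · exact mul_le_mul_of_nonneg_left hab (EReal.coe_nonneg.2 hγ.le)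
  · exact Function.LeftInverse.injective (g := fun y => ((1 / M.γ : ℝ) : EReal) * y)
      (inv_gamma_mul_gamma_mul hγ)

theorem expScale_le_iff {a b : EReal} : M.expScale a ≤ M.expScale b ↔ a ≤ b :=
  (expScale_strictMono hγ).le_iff_le

/-- An order isomorphism commutes with all infima, so the infimum may be taken after exponentiating.
-/
theorem expScale_iInf {ι : Sort*} (y : ι → EReal) :
    M.expScale (⨅ i, y i) = ⨅ i, M.expScale (y i) :=
  map_iInf ((expScale_strictMono hγ).orderIsoOfSurjective _ fun x =>
    ⟨_, expScale_inv_gamma_log hγ x⟩) y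

theorem expScale_min (a b : EReal) :
    M.expScale (min a b) = min (M.expScale a) (M.expScale b) :=
  (expScale_strictMono hγ).monotone.map_min

/-- No finiteness is needed: the conventions `⊤ + ⊥ = ⊥` and `∞ * 0 = 0` agree under the
exponential. -/
theorem expScale_add (a b : EReal) : M.expScale (a + b) = M.expScale a * M.expScale b := by
  rw [expScale, EReal.left_distrib_of_nonneg_of_ne_top (EReal.coe_nonneg.2 hγ.le)
    (EReal.coe_ne_top _), EReal.exp_add]
  rfl

omit hγ in
theorem expScale_coe (r : ℝ) : M.expScale r = ENNReal.ofReal (Real.exp (M.γ * r)) := by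
  rw [expScale, ← EReal.coe_mul, EReal.exp_coe]

theorem expScale_entropic [MeasurableSpace Ω] (P : Measure Ω) (Y : Ω → EReal) :
    M.expScale (M.entropic P Y) = ∫⁻ ω, M.expScale (Y ω) ∂P :=
  expScale_inv_gamma_log hγ _

end ExpScale

/-! ### Bounds on the market impact functions -/

section Impact

variable [mΩ : MeasurableSpace Ω] {M : Model Ω} {ℱ : Filtration ℕ mΩ} {P : Measure Ω}

theorem Standing.intervalIntegrable_abs (hM : M.Standing ℱ P) (a b : ℝ) :
    IntervalIntegrable (fun y => M.f |y|) volume a b := by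
  have hpos : ∀ x, 0 ≤ x → IntervalIntegrable (fun y => M.f |y|) volume 0 x := by
    intro x hx
    rcases hx.eq_or_lt with rfl | hx
    · exact IntervalIntegrable.refl
    · refine (hM.f_integrable x hx).congr fun y hy => ?_
      rw [Set.uIoc_of_le hx.le] at hy
      simp [abs_of_pos hy.1]
  have hall : ∀ x, IntervalIntegrable (fun y => M.f |y|) volume 0 x := by
    intro x
    rcases le_total 0 x with hx | hx
    · exact hpos x hx
    · have := (IntervalIntegrable.iff_comp_neg).1 (hpos (-x) (by linarith))
      simpa using this
  exact (hall a).symm.trans (hall b)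

omit mΩ in
theorem G_eq (M : Model Ω) (q : ℝ) : M.G q = ∫ y in (0 : ℝ)..(M.Q - q), M.f |y| := by
  rw [G, intervalIntegral.integral_comp_sub_left (fun y => M.f |y|), sub_self]

theorem Standing.continuous_G (hM : M.Standing ℱ P) : Continuous M.G := by
  rw [show M.G = fun q => ∫ y in (0 : ℝ)..(M.Q - q), M.f |y| from funext M.G_eq]
  exact (intervalIntegral.continuous_primitive hM.intervalIntegrable_abs 0).comp
    (continuous_const.sub continuous_id)

/-- The possible singularity of `f` at `0` is paid for by the integral over `[0, 1]`; beyond `1`,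
monotonicity gives `f ≤ f 1`. -/
theorem Standing.abs_primitive_le (hM : M.Standing ℱ P) {x : ℝ} (hx : 0 ≤ x) :
    |(∫ y in (0 : ℝ)..x, M.f |y|)| ≤ (∫ y in (0 : ℝ)..1, M.f |y|) + M.f 1 * x := by
  have hnn : ∀ a b, 0 ≤ a → a ≤ b → 0 ≤ ∫ y in a..b, M.f |y| := by
    intro a b ha hab
    rw [intervalIntegral.integral_of_le hab]
    refine setIntegral_nonneg measurableSet_Ioc fun y hy => hM.f_nonneg _ ?_
    exact abs_pos_of_pos (ha.trans_lt hy.1)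
  have hI := hM.intervalIntegrable_abs
  have hf1 := hM.f_nonneg 1 one_pos
  rw [abs_of_nonneg (hnn 0 x le_rfl hx)]
  rcases le_total x 1 with h | h
  · have := intervalIntegral.integral_add_adjacent_intervals (hI 0 x) (hI x 1)
    nlinarith [hnn x 1 hx h, mul_nonneg hf1 hx]
  · rw [← intervalIntegral.integral_add_adjacent_intervals (hI 0 1) (hI 1 x)]
    have : ∫ y in (1 : ℝ)..x, M.f |y| ≤ ∫ y in (1 : ℝ)..x, M.f 1 := by
      refine intervalIntegral.integral_mono_on h (hI 1 x) (by simp) fun y hy => ?_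
      have hy0 : (0 : ℝ) < y := one_pos.trans_le hy.1
      rw [abs_of_pos hy0]
      exact hM.f_anti (Set.mem_Ioi.2 one_pos) hy0 hy.1
    rw [intervalIntegral.integral_const, smul_eq_mul] at this
    nlinarith

theorem Standing.exists_abs_G_le (hM : M.Standing ℱ P) :
    ∃ C, 0 ≤ C ∧ ∀ q, |M.G q| ≤ C * (1 + |q|) := by
  set I := |(∫ y in (0 : ℝ)..1, M.f |y|)|
  have hf1 := hM.f_nonneg 1 one_pos
  have key : ∀ x, |(∫ y in (0 : ℝ)..x, M.f |y|)| ≤ I + M.f 1 * |x| := by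
    intro x
    rcases le_total 0 x with hx | hx
    · rw [abs_of_nonneg hx]
      exact (hM.abs_primitive_le hx).trans (by gcongr; exact le_abs_self _)
    · have h := hM.abs_primitive_le (x := -x) (by linarith)
      have h2 : ∫ y in (0 : ℝ)..(-x), M.f |y| = - ∫ y in (0 : ℝ)..x, M.f |y| := by
        have := intervalIntegral.integral_comp_neg (a := 0) (b := -x) (fun y => M.f |y|)
        simp only [abs_neg, neg_neg, neg_zero] at this
        rw [this, intervalIntegral.integral_symm]
      rw [h2, abs_neg] at h
      rw [abs_of_nonpos hx]
      exact h.trans (by gcongr; exact le_abs_self _)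
  have hI : 0 ≤ I := abs_nonneg _
  refine ⟨I + M.f 1 * (|M.Q| + 1), by positivity, fun q => ?_⟩
  rw [G_eq]
  refine (key _).trans ?_
  have h1 := abs_sub M.Q q
  have h2 := mul_le_mul_of_nonneg_left h1 hf1
  nlinarith [mul_nonneg hI (abs_nonneg q), mul_nonneg hf1 (abs_nonneg q),
    mul_nonneg hf1 (mul_nonneg (abs_nonneg M.Q) (abs_nonneg q))]

theorem Standing.continuous_ell (hM : M.Standing ℱ P) : Continuous M.ell :=
  continuousOn_univ.1 (hM.ell_convex.continuousOn isOpen_univ)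

theorem Standing.ell_nonneg (hM : M.Standing ℱ P) (q : ℝ) : 0 ≤ M.ell q := by
  have h : ∀ x, 0 ≤ x → 0 ≤ M.ell x := fun x hx => by
    have := hM.ell_mono Set.self_mem_Ici hx hx
    rwa [hM.ell_zero] at this
  rcases le_total 0 q with hq | hq
  · exact h q hq
  · rw [← hM.ell_even]
    exact h _ (by linarith)

/-- Superlinearity beats any prescribed slope `K`; on the remaining bounded range of `|ρ|`,
nonnegativity of `L` is enough. -/
theorem Standing.exists_L_ge (hM : M.Standing ℱ P) {K : ℝ} (hK : 0 ≤ K) :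
    ∃ C, 0 ≤ C ∧ ∀ ρ, K * |ρ| - C ≤ M.L ρ := by
  obtain ⟨R, hR⟩ := (hM.L_superlinear.eventually_ge_atTop K).exists_forall_of_atTop
  refine ⟨K * max R 1, by positivity, ?_⟩
  have key : ∀ ρ, 0 ≤ ρ → K * ρ - K * max R 1 ≤ M.L ρ := by
    intro ρ hρ
    rcases le_total (max R 1) ρ with h | h
    · have h0 : 0 < ρ := one_pos.trans_le ((le_max_right _ _).trans h)
      have := (le_div_iff₀ h0).1 (hR ρ ((le_max_left _ _).trans h))
      have : 0 ≤ K * max R 1 := by positivity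
      linarith
    · have := mul_le_mul_of_nonneg_left h hK
      linarith [hM.L_nonneg ρ]
  intro ρ
  rcases le_total 0 ρ with h | h
  · rw [abs_of_nonneg h]; exact key ρ h
  · rw [abs_of_nonpos h, ← hM.L_even]; exact key _ (by linarith)

theorem Standing.exists_execution_cost_ge (hM : M.Standing ℱ P) {K : ℝ} (hK : 0 ≤ K) :
    ∃ C, 0 ≤ C ∧ ∀ v w, 0 < w → K * |v| - C * w ≤ M.L (v / w) * w := by
  obtain ⟨C, hC, h⟩ := hM.exists_L_ge hK
  refine ⟨C, hC, fun v w hw => ?_⟩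
  have := mul_le_mul_of_nonneg_right (h (v / w)) hw.le
  rw [abs_div, abs_of_pos hw, sub_mul, mul_assoc, div_mul_cancel₀ _ hw.ne'] at this
  exact this

end Impact

/-! ### The dynamic programming operator -/

/-- Positive paths of market volumes. -/
abbrev Vol (M : Model Ω) : Type :=
  {w : ℕ → ℝ // ∀ k, 1 ≤ k → k ≤ M.N → 0 < w k}

instance (M : Model Ω) : SecondCountableTopology M.Vol :=
  Topology.IsInducing.subtypeVal.secondCountableTopology

/-- The part of the running cost of one day which does not involve the execution costs. -/
def riskCost (M : Model Ω) (n : ℕ) (q Z v e e' : ℝ) : ℝ :=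
  M.σ * √M.δt * ((q - M.Q / (n + 1)) * e - M.Q / (n + 1) * Z)
    - M.σ * v * M.δt ^ (3 / 2 : ℝ) / √3 * e'
    - M.Q / (n + 1) * (M.G (q - v * M.δt) - M.G q)

/-- The running cost of one day, as a function of the innovations. -/
def runningCost (M : Model Ω) (w : ℕ → ℝ) (n : ℕ) (q Z v e e' : ℝ) : ℝ :=
  M.riskCost n q Z v e e' + M.L (v / w (n + 1)) * w (n + 1) * M.δt

/-- The spread at the end of the day. -/
def nextSpread (M : Model Ω) (n : ℕ) (q Z v e : ℝ) : ℝ :=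
  (n : ℝ) / (n + 1) * (Z + e + (M.G (q - v * M.δt) - M.G q) / (M.σ * √M.δt))

section

variable [mΩ : MeasurableSpace Ω] (M : Model Ω) (P : Measure Ω)

/-- `exp(γ θ_n)`. -/
def expTheta (n : ℕ) (p : M.Vol × ℝ × ℝ) : ℝ≥0∞ :=
  M.expScale (M.theta P p.1 n p.2.1 p.2.2)

/-- The exponential of `γ` times the functional minimised at time `n`. -/
def expObjective (n : ℕ) (p : M.Vol × ℝ × ℝ) (v : ℝ) : ℝ≥0∞ :=
  M.expScale (M.objective P p.1 n p.2.1 p.2.2 v)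

/-- The integrand of `expObjective`, as a function of the state, the order and the innovations. -/
def expCost (n : ℕ) (z : ((M.Vol × ℝ × ℝ) × ℝ) × (ℝ × ℝ)) : ℝ≥0∞ :=
  ENNReal.ofReal (Real.exp
      (M.γ * M.runningCost z.1.1.1 n z.1.1.2.1 z.1.1.2.2 z.1.2 z.2.1 z.2.2))
    * M.expTheta P (n + 1) (z.1.1.1, z.1.1.2.1 - z.1.2 * M.δt,
        M.nextSpread n z.1.1.2.1 z.1.1.2.2 z.1.2 z.2.1)

variable {M P} {ℱ : Filtration ℕ mΩ}

theorem expObjective_eq_lintegral (hγ : 0 < M.γ) (n : ℕ) (p : M.Vol × ℝ × ℝ) (v : ℝ) :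
    M.expObjective P n p v
      = ∫⁻ ω, M.expCost P n ((p, v), (M.ε (n + 1) ω, M.ε' (n + 1) ω)) ∂P := by
  rw [expObjective, objective, stepFunctional, expScale_entropic hγ]
  refine lintegral_congr fun ω => ?_
  rw [expScale_add hγ, expScale_coe]
  rfl

theorem expTheta_terminal (p : M.Vol × ℝ × ℝ) :
    M.expTheta P M.N p = M.expScale (M.deliveryCost p.2.1) := by
  rw [expTheta, theta_terminal]

theorem expScale_thetaTilde (hγ : 0 < M.γ) (n : ℕ) (p : M.Vol × ℝ × ℝ) :
    M.expScale (M.thetaTilde P p.1 n p.2.1 p.2.2) = ⨅ v, M.expObjective P n p v :=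
  expScale_iInf hγ _

theorem expTheta_of_mem (hγ : 0 < M.γ) {n : ℕ} (hn : n < M.N) (h : n ∈ M.deliveryDates)
    (p : M.Vol × ℝ × ℝ) :
    M.expTheta P n p
      = min (⨅ v, M.expObjective P n p v) (M.expScale (M.deliveryCost p.2.1)) := by
  rw [expTheta, theta_of_mem _ _ _ hn h, expScale_min hγ, expScale_thetaTilde hγ]

theorem expTheta_of_notMem (hγ : 0 < M.γ) {n : ℕ} (hn : n < M.N) (h : n ∉ M.deliveryDates)
    (p : M.Vol × ℝ × ℝ) :
    M.expTheta P n p = ⨅ v, M.expObjective P n p v := by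
  rw [expTheta, theta_of_notMem _ _ _ hn h, expScale_thetaTilde hγ]

theorem Standing.continuous_runningCost (hM : M.Standing ℱ P) {n : ℕ} (hn : n < M.N) :
    Continuous fun z : ((M.Vol × ℝ × ℝ) × ℝ) × (ℝ × ℝ) =>
      M.runningCost z.1.1.1 n z.1.1.2.1 z.1.1.2.2 z.1.2 z.2.1 z.2.2 := by
  have hG := hM.continuous_G
  have hL := hM.L_continuous
  have hw : Continuous fun z : ((M.Vol × ℝ × ℝ) × ℝ) × (ℝ × ℝ) =>
      (z.1.1.1 : ℕ → ℝ) (n + 1) :=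
    (continuous_apply (n + 1)).comp (continuous_subtype_val.comp (by fun_prop))
  have hw0 : ∀ z : ((M.Vol × ℝ × ℝ) × ℝ) × (ℝ × ℝ), (z.1.1.1 : ℕ → ℝ) (n + 1) ≠ 0 :=
    fun z => (z.1.1.1.2 (n + 1) (by omega) (by omega)).ne'
  have hdiv : Continuous fun z : ((M.Vol × ℝ × ℝ) × ℝ) × (ℝ × ℝ) =>
      z.1.2 / (z.1.1.1 : ℕ → ℝ) (n + 1) := Continuous.div (by fun_prop) hw hw0
  unfold runningCost riskCost
  have := hL.comp hdiv
  exact Continuous.add (by fun_prop) ((this.mul hw).mul continuous_const)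

theorem Standing.continuous_nextSpread (hM : M.Standing ℱ P) (n : ℕ) :
    Continuous fun z : ((M.Vol × ℝ × ℝ) × ℝ) × (ℝ × ℝ) =>
      M.nextSpread n z.1.1.2.1 z.1.1.2.2 z.1.2 z.2.1 := by
  have hG := hM.continuous_G
  unfold nextSpread
  fun_prop

theorem Standing.lowerSemicontinuous_expCost (hM : M.Standing ℱ P) {n : ℕ} (hn : n < M.N)
    (hΘ : LowerSemicontinuous (M.expTheta P (n + 1))) :
    LowerSemicontinuous (M.expCost P n) := by
  have h₁ := hM.continuous_runningCost hn
  have h₂ := hM.continuous_nextSpread n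
  exact LowerSemicontinuous.ofReal_exp_mul (continuous_const.mul h₁)
    (hΘ.comp (by fun_prop))

theorem Standing.measurable_innovations (hM : M.Standing ℱ P) {n : ℕ} (hn : n < M.N) :
    Measurable fun ω => (M.ε (n + 1) ω, M.ε' (n + 1) ω) :=
  ((hM.ε_measurable (n + 1) (by omega) (by omega)).mono (ℱ.le _) le_rfl).prodMk
    ((hM.ε'_measurable (n + 1) (by omega) (by omega)).mono (ℱ.le _) le_rfl)

theorem Standing.lowerSemicontinuous_expObjective (hM : M.Standing ℱ P) {n : ℕ} (hn : n < M.N)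
    (hΘ : LowerSemicontinuous (M.expTheta P (n + 1))) :
    LowerSemicontinuous fun z : (M.Vol × ℝ × ℝ) × ℝ => M.expObjective P n z.1 z.2 := by
  simp_rw [expObjective_eq_lintegral hM.γ_pos]
  have h := hM.lowerSemicontinuous_expCost hn hΘ
  refine lowerSemicontinuous_lintegral P (fun ω => h.comp (by fun_prop)) fun z => ?_
  exact h.measurable.comp (measurable_const.prodMk (hM.measurable_innovations hn))

/-! ### Growth bounds and coercivity of the one-day objective -/

omit mΩ in
theorem abs_riskCost_le_aux {m a r g K B q Z v e e' Δ : ℝ} (hm : 0 ≤ m) (ha : 0 ≤ a) (hr : 0 ≤ r)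
    (hK : 0 ≤ K) (hB : 1 ≤ B) (hq : |q| ≤ B) (hZ : |Z| ≤ B) (hv : |v| ≤ B) (he : |e| ≤ K)
    (he' : |e'| ≤ K) (hΔ : |Δ| ≤ g * B) :
    |m * ((q - a) * e - a * Z) - r * v * e' - a * Δ|
      ≤ (m * K + m * a * K + m * a + r * K + a * g) * B := by
  have hB0 : 0 ≤ B := by linarith
  have b₁ : |m * (q * e)| ≤ m * (B * K) := by
    rw [abs_mul, abs_mul, abs_of_nonneg hm]
    gcongr
  have b₂ : |m * a * e| ≤ m * a * K * B := by
    rw [abs_mul, abs_of_nonneg (by positivity : 0 ≤ m * a)]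
    calc m * a * |e| ≤ m * a * K := by gcongr
      _ ≤ m * a * K * B := le_mul_of_one_le_right (by positivity) hB
  have b₃ : |m * a * Z| ≤ m * a * B := by
    rw [abs_mul, abs_of_nonneg (by positivity : 0 ≤ m * a)]
    gcongr
  have b₄ : |r * (v * e')| ≤ r * (B * K) := by
    rw [abs_mul, abs_mul, abs_of_nonneg hr]
    gcongr
  have b₅ : |a * Δ| ≤ a * (g * B) := by
    rw [abs_mul, abs_of_nonneg ha]
    gcongr
  rw [abs_le] at b₁ b₂ b₃ b₄ b₅ ⊢
  constructor <;> linarith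

theorem Standing.exists_linear_growth (hM : M.Standing ℱ P) (n : ℕ) {K : ℝ} (hK : 0 ≤ K) :
    ∃ c, 0 ≤ c ∧ ∀ q Z v e e', |e| ≤ K → |e'| ≤ K →
      |M.riskCost n q Z v e e'| ≤ c * (1 + |q| + |Z| + |v|) ∧
      |q - v * M.δt| ≤ c * (1 + |q| + |Z| + |v|) ∧
      |M.nextSpread n q Z v e| ≤ c * (1 + |q| + |Z| + |v|) := by
  obtain ⟨C, hC, hG⟩ := hM.exists_abs_G_le
  have hδ := hM.δt_pos
  have hn : (0 : ℝ) < n + 1 := by positivity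
  have hm : 0 < M.σ * √M.δt := mul_pos hM.σ_pos (Real.sqrt_pos.2 hδ)
  have ha : 0 ≤ M.Q / (n + 1) := div_nonneg hM.Q_pos.le hn.le
  have hr : 0 ≤ M.σ * M.δt ^ (3 / 2 : ℝ) / √3 :=
    div_nonneg (mul_nonneg hM.σ_pos.le (Real.rpow_nonneg hδ.le _)) (Real.sqrt_nonneg _)
  have hfrac : |(n : ℝ) / (n + 1)| ≤ 1 := by
    rw [abs_of_nonneg (by positivity), div_le_one hn]
    linarith
  have hrisk : ∀ q Z v e e', M.riskCost n q Z v e e'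
      = M.σ * √M.δt * ((q - M.Q / (n + 1)) * e - M.Q / (n + 1) * Z)
        - M.σ * M.δt ^ (3 / 2 : ℝ) / √3 * v * e'
        - M.Q / (n + 1) * (M.G (q - v * M.δt) - M.G q) := by
    intros
    unfold riskCost
    ring
  simp_rw [hrisk, nextSpread]
  generalize M.σ * √M.δt = m at *
  generalize M.Q / (n + 1) = a at *
  generalize M.σ * M.δt ^ (3 / 2 : ℝ) / √3 = r at *
  have hg : 0 ≤ C * (2 + M.δt) := by positivity
  have hg' : ∀ q Z v, |M.G (q - v * M.δt) - M.G q|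
      ≤ C * (2 + M.δt) * (1 + |q| + |Z| + |v|) := by
    intro q Z v
    have hq0 := abs_nonneg q
    have hZ0 := abs_nonneg Z
    have hq' : |q - v * M.δt| ≤ |q| + |v| * M.δt := by
      refine (abs_sub _ _).trans ?_
      rw [abs_mul, abs_of_pos hδ]
    refine (abs_sub _ _).trans ((add_le_add (hG _) (hG _)).trans ?_)
    rw [← mul_add, mul_assoc]
    refine mul_le_mul_of_nonneg_left ?_ hC
    nlinarith [mul_nonneg hδ.le hq0, mul_nonneg hδ.le hZ0, abs_nonneg v]
  generalize C * (2 + M.δt) = g at *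
  have h₁ : 0 ≤ m * K + m * a * K + m * a + r * K + a * g := by positivity
  have h₃ : 0 ≤ 1 + K + g / m := by positivity
  -- The sum of three slopes, one each for the risk cost, the next inventory and the next spread, so
  -- that a single constant serves all bounds.
  refine ⟨(m * K + m * a * K + m * a + r * K + a * g) + (1 + M.δt) + (1 + K + g / m),
    by positivity, fun q Z v e e' he he' => ?_⟩
  have hΔ := hg' q Z v
  have hq0 := abs_nonneg q
  have hZ0 := abs_nonneg Z
  have hv0 := abs_nonneg v
  have hB : 1 ≤ 1 + |q| + |Z| + |v| := by linarith
  have hqB : |q| ≤ 1 + |q| + |Z| + |v| := by linarith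
  have hZB : |Z| ≤ 1 + |q| + |Z| + |v| := by linarith
  have hvB : |v| ≤ 1 + |q| + |Z| + |v| := by linarith
  generalize 1 + |q| + |Z| + |v| = B at *
  have hB0 : 0 ≤ B := by linarith
  refine ⟨(abs_riskCost_le_aux hm.le ha hr hK hB hqB hZB hvB he he' hΔ).trans ?_, ?_, ?_⟩
  · refine mul_le_mul_of_nonneg_right ?_ hB0
    linarith
  · refine (abs_sub _ _).trans ?_
    rw [abs_mul, abs_of_pos hδ]
    have h1 : |v| * M.δt ≤ B * M.δt := by gcongr
    have h2 := mul_nonneg (add_nonneg h₁ h₃) hB0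
    linarith
  · rw [abs_mul]
    have b : |(M.G (q - v * M.δt) - M.G q) / m| ≤ g / m * B := by
      rw [abs_div, abs_of_pos hm, div_mul_eq_mul_div]
      gcongr
    have h2 : |Z + e + (M.G (q - v * M.δt) - M.G q) / m| ≤ (1 + K + g / m) * B := by
      refine (abs_add_three _ _ _).trans ?_
      have : K ≤ K * B := le_mul_of_one_le_right hK hB
      linarith
    refine (mul_le_mul hfrac h2 (abs_nonneg _) zero_le_one).trans ?_
    rw [one_mul]
    refine mul_le_mul_of_nonneg_right ?_ hB0
    linarith

/-- `Θ` is bounded from below by the exponential of an affine function of the state, locally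
uniformly in the volumes. -/
def HasExpLowerBound (Θ : M.Vol × ℝ × ℝ → ℝ≥0∞) : Prop :=
  ∀ w₀, ∃ C, 0 ≤ C ∧ ∀ᶠ w in 𝓝 w₀, ∀ q Z,
    ENNReal.ofReal (Real.exp (-(C * (1 + |q| + |Z|)))) ≤ Θ (w, q, Z)

/-- The integral is bounded below by its part over an event of probability at least `exp (-1)` on
which both innovations are bounded by `K`. There the execution cost dominates every other term. -/
theorem Standing.expObjective_ge [IsProbabilityMeasure P] (hM : M.Standing ℱ P) {n : ℕ}
    (hn : n < M.N) (hΘ : HasExpLowerBound (M.expTheta P (n + 1))) (w₀ : M.Vol) :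
    ∃ C, 0 ≤ C ∧ ∀ᶠ w in 𝓝 w₀, ∀ q Z v,
      ENNReal.ofReal (Real.exp (|v| - C * (1 + |q| + |Z|)))
        ≤ M.expObjective P n (w, q, Z) v := by
  obtain ⟨C, hC, hΘ⟩ := hΘ w₀
  obtain ⟨K, hK, hP⟩ := exists_bound_of_isProbabilityMeasure P
    fun ω => |M.ε (n + 1) ω| + |M.ε' (n + 1) ω|
  obtain ⟨c, hc, hgrowth⟩ := hM.exists_linear_growth n hK
  have hγ := hM.γ_pos
  have hδ := hM.δt_pos
  -- The rate, per unit of `1 + |q| + |Z| + |v|`, at which risk cost and continuation value together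
  -- can lower the exponent.
  set c' := M.γ * c + C * (1 + 2 * c) with hc'
  have hc'0 : 0 ≤ c' := by positivity
  -- This slope makes the execution cost contribute `(c' + 1) |v|` to the exponent, leaving a net
  -- `|v|` after the loss `c' |v|`.
  obtain ⟨CL, hCL, hL⟩ := hM.exists_execution_cost_ge
    (K := (c' + 1) / (M.γ * M.δt)) (by positivity)
  -- A bound on the volume near `w₀`: the execution cost estimate loses a multiple of the volume.
  set b := w₀.1 (n + 1) + 1 with hb
  have hb0 : 0 < b := by linarith [w₀.2 (n + 1) (by omega) (by omega)]
  have hwb : ∀ᶠ w : M.Vol in 𝓝 w₀, w.1 (n + 1) < b :=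
    ((continuous_apply (n + 1)).comp continuous_subtype_val).continuousAt.eventually
      (gt_mem_nhds (by simp [hb]))
  -- The last `1` absorbs the probability `exp (-1)`.
  refine ⟨c' + M.γ * M.δt * CL * b + 1, by positivity, ?_⟩
  filter_upwards [hΘ, hwb] with w hw hwb q Z v
  have hw0 := w.2 (n + 1) (by omega) (by omega)
  set D := 1 + |q| + |Z| with hD
  have hD1 : 1 ≤ D := by linarith [abs_nonneg q, abs_nonneg Z]
  have hinn := hM.measurable_innovations hn
  have hSm : MeasurableSet {ω | |M.ε (n + 1) ω| + |M.ε' (n + 1) ω| ≤ K} :=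
    measurableSet_le (hinn.fst.abs.add hinn.snd.abs) measurable_const
  set E := -(c' * (D + |v|)) + ((c' + 1) * |v| - M.γ * M.δt * CL * b) with hE
  have hpoint : ∀ ω ∈ {ω | |M.ε (n + 1) ω| + |M.ε' (n + 1) ω| ≤ K},
      ENNReal.ofReal (Real.exp E)
        ≤ M.expCost P n (((w, q, Z), v), (M.ε (n + 1) ω, M.ε' (n + 1) ω)) := by
    intro ω hω
    have hω' : |M.ε (n + 1) ω| + |M.ε' (n + 1) ω| ≤ K := hω
    obtain ⟨h₁, h₂, h₃⟩ := hgrowth q Z v (M.ε (n + 1) ω) (M.ε' (n + 1) ω)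
      (by linarith [abs_nonneg (M.ε' (n + 1) ω)]) (by linarith [abs_nonneg (M.ε (n + 1) ω)])
    unfold expCost
    refine le_trans ?_ (mul_le_mul_right (hw _ _) _)
    rw [← ENNReal.ofReal_mul (Real.exp_pos _).le, ← Real.exp_add]
    refine ENNReal.ofReal_le_ofReal (Real.exp_le_exp.2 ?_)
    simp only [runningCost]
    have hexec : (c' + 1) * |v| - M.γ * M.δt * CL * b
        ≤ M.γ * (M.L (v / w.1 (n + 1)) * w.1 (n + 1) * M.δt) := by
      have := mul_le_mul_of_nonneg_left (hL v (w.1 (n + 1)) hw0) (mul_pos hγ hδ).le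
      have e : M.γ * M.δt * ((c' + 1) / (M.γ * M.δt) * |v| - CL * w.1 (n + 1))
          = (c' + 1) * |v| - M.γ * M.δt * CL * w.1 (n + 1) := by
        field_simp
      rw [e] at this
      have h' : M.γ * M.δt * CL * w.1 (n + 1) ≤ M.γ * M.δt * CL * b := by gcongr
      linarith
    have hrisk := mul_le_mul_of_nonneg_left (abs_le.1 h₁).1 hγ.le
    have hcont : C * (1 + |q - v * M.δt| + |M.nextSpread n q Z v (M.ε (n + 1) ω)|)
        ≤ C * (1 + 2 * c) * (D + |v|) := by
      rw [mul_assoc]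
      gcongr
      nlinarith [abs_nonneg v]
    rw [hE, mul_add, hc']
    linarith
  rw [expObjective_eq_lintegral hγ]
  calc ENNReal.ofReal (Real.exp (|v| - (c' + M.γ * M.δt * CL * b + 1) * D))
      ≤ ENNReal.ofReal (Real.exp E) * ENNReal.ofReal (Real.exp (-1)) := by
        rw [← ENNReal.ofReal_mul (Real.exp_pos _).le, ← Real.exp_add]
        refine ENNReal.ofReal_le_ofReal (Real.exp_le_exp.2 ?_)
        have : M.γ * M.δt * CL * b ≤ M.γ * M.δt * CL * b * D :=
          le_mul_of_one_le_right (by positivity) hD1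
        rw [hE]
        linarith
    _ ≤ ENNReal.ofReal (Real.exp E) * P {ω | |M.ε (n + 1) ω| + |M.ε' (n + 1) ω| ≤ K} := by
        gcongr
    _ = ∫⁻ _ in {ω | |M.ε (n + 1) ω| + |M.ε' (n + 1) ω| ≤ K},
          ENNReal.ofReal (Real.exp E) ∂P := (setLIntegral_const _ _).symm
    _ ≤ _ := (setLIntegral_mono' hSm hpoint).trans (setLIntegral_le_lintegral _ _)

theorem Standing.locallyCoercive_expObjective [IsProbabilityMeasure P] (hM : M.Standing ℱ P)
    {n : ℕ} (hn : n < M.N) (hΘ : HasExpLowerBound (M.expTheta P (n + 1))) :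
    LocallyCoercive (M.expObjective P n) := by
  rintro ⟨w₀, q₀, Z₀⟩
  obtain ⟨C, hC, h⟩ := hM.expObjective_ge hn hΘ w₀
  refine ⟨C * (1 + (|q₀| + 1) + (|Z₀| + 1)), ?_⟩
  have hq : ∀ᶠ q : ℝ in 𝓝 q₀, |q| < |q₀| + 1 :=
    continuous_abs.continuousAt.eventually (gt_mem_nhds (by simp))
  have hZ : ∀ᶠ Z : ℝ in 𝓝 Z₀, |Z| < |Z₀| + 1 :=
    continuous_abs.continuousAt.eventually (gt_mem_nhds (by simp))
  rw [nhds_prod_eq, nhds_prod_eq]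
  filter_upwards [h.prod_mk (hq.prod_mk hZ)] with p hp v
  refine le_trans ?_ (hp.1 p.2.1 p.2.2 v)
  refine ENNReal.ofReal_le_ofReal (Real.exp_le_exp.2 ?_)
  have := hp.2.1.le
  have := hp.2.2.le
  gcongr

theorem Standing.hasExpLowerBound_deliveryCost (hM : M.Standing ℱ P) :
    HasExpLowerBound fun p : M.Vol × ℝ × ℝ => M.expScale (M.deliveryCost p.2.1) := by
  intro w₀
  have hγ := hM.γ_pos
  refine ⟨M.γ * |M.F 0|, by positivity, Eventually.of_forall fun w q Z => ?_⟩
  refine le_trans ?_ (expScale_coe _).ge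
  refine ENNReal.ofReal_le_ofReal (Real.exp_le_exp.2 ?_)
  have h₁ : M.γ * |M.F 0| ≤ M.γ * |M.F 0| * (1 + |q| + |Z|) :=
    le_mul_of_one_le_right (by positivity) (by linarith [abs_nonneg q, abs_nonneg Z])
  have h₂ : M.γ * -|M.F 0| ≤ M.γ * M.deliveryCost q :=
    mul_le_mul_of_nonneg_left (by
      unfold deliveryCost
      linarith [hM.ell_nonneg q, neg_abs_le (M.F 0)]) hγ.le
  linarith

theorem Standing.continuous_expScale_deliveryCost (hM : M.Standing ℱ P) :
    Continuous fun p : M.Vol × ℝ × ℝ => M.expScale (M.deliveryCost p.2.1) := by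
  have := hM.continuous_ell
  simp_rw [expScale_coe, deliveryCost]
  refine ENNReal.continuous_ofReal.comp ?_
  fun_prop

theorem Standing.hasExpLowerBound_iInf [IsProbabilityMeasure P] (hM : M.Standing ℱ P) {n : ℕ}
    (hn : n < M.N) (hΘ : HasExpLowerBound (M.expTheta P (n + 1))) :
    HasExpLowerBound fun p : M.Vol × ℝ × ℝ => ⨅ v, M.expObjective P n p v := by
  intro w₀
  obtain ⟨C, hC, h⟩ := hM.expObjective_ge hn hΘ w₀
  refine ⟨C, hC, h.mono fun w hw q Z => le_iInf fun v => le_trans ?_ (hw q Z v)⟩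
  refine ENNReal.ofReal_le_ofReal (Real.exp_le_exp.2 ?_)
  linarith [abs_nonneg v]

/-- The two properties must be propagated together: the lower bound at `n + 1` yields coercivity at
`n`, without which semicontinuity would not survive the infimum over orders. -/
theorem Standing.expTheta_regular [IsProbabilityMeasure P] (hM : M.Standing ℱ P) {n : ℕ}
    (hn : n ≤ M.N) :
    LowerSemicontinuous (M.expTheta P n) ∧ HasExpLowerBound (M.expTheta P n) := by
  have hγ := hM.γ_pos
  induction hn using Nat.decreasingInduction with
  | self =>
    rw [show M.expTheta P M.N = _ from funext expTheta_terminal]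
    exact ⟨hM.continuous_expScale_deliveryCost.lowerSemicontinuous,
      hM.hasExpLowerBound_deliveryCost⟩
  | of_succ n hn ih =>
    have hlsc := (hM.locallyCoercive_expObjective hn ih.2).lowerSemicontinuous_iInf
      (hM.lowerSemicontinuous_expObjective hn ih.1)
    have hbd := hM.hasExpLowerBound_iInf hn ih.2
    by_cases h : n ∈ M.deliveryDates
    · rw [show M.expTheta P n = _ from funext (expTheta_of_mem hγ hn h)]
      refine ⟨hlsc.inf hM.continuous_expScale_deliveryCost.lowerSemicontinuous, fun w₀ => ?_⟩
      obtain ⟨C₁, hC₁, h₁⟩ := hbd w₀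
      obtain ⟨C₂, hC₂, h₂⟩ := hM.hasExpLowerBound_deliveryCost w₀
      refine ⟨max C₁ C₂, by positivity, ?_⟩
      filter_upwards [h₁, h₂] with w h₁ h₂ q Z
      refine le_min (le_trans ?_ (h₁ q Z)) (le_trans ?_ (h₂ q Z)) <;>
        refine ENNReal.ofReal_le_ofReal (Real.exp_le_exp.2 (neg_le_neg ?_)) <;> gcongr
      · exact le_max_left _ _
      · exact le_max_right _ _
    · rw [show M.expTheta P n = _ from funext (expTheta_of_notMem hγ hn h)]
      exact ⟨hlsc, hbd⟩

variable [IsProbabilityMeasure P]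

theorem Standing.measurable_expCost (hM : M.Standing ℱ P) {n : ℕ} (hn : n < M.N) :
    Measurable (M.expCost P n) :=
  (hM.lowerSemicontinuous_expCost hn (hM.expTheta_regular hn).1).measurable

theorem Standing.measurable_iInf_expObjective (hM : M.Standing ℱ P) {n : ℕ} (hn : n < M.N) :
    Measurable fun p => ⨅ v, M.expObjective P n p v :=
  ((hM.locallyCoercive_expObjective hn (hM.expTheta_regular hn).2).lowerSemicontinuous_iInf
    (hM.lowerSemicontinuous_expObjective hn (hM.expTheta_regular hn).1)).measurable

omit [IsProbabilityMeasure P] in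
theorem mem_argmin_objective_iff (hγ : 0 < M.γ) {n : ℕ} {p : M.Vol × ℝ × ℝ} {v : ℝ} :
    v ∈ argmin (M.objective P p.1 n p.2.1 p.2.2)
      ↔ M.expObjective P n p v ≤ ⨅ v', M.expObjective P n p v' := by
  simp only [argmin, Set.mem_ofPred_eq, le_iInf_iff, expObjective, expScale_le_iff hγ]

theorem Standing.exists_selector (hM : M.Standing ℱ P) {n : ℕ} (hn : n < M.N) :
    ∃ φ : M.Vol × ℝ × ℝ → ℝ, Measurable φ ∧
      ∀ p, φ p ∈ argmin (M.objective P p.1 n p.2.1 p.2.2) := by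
  obtain ⟨φ, hφ, h⟩ := (hM.locallyCoercive_expObjective hn
    (hM.expTheta_regular hn).2).exists_measurable_minimiser
    (hM.lowerSemicontinuous_expObjective hn (hM.expTheta_regular hn).1)
  exact ⟨φ, hφ, fun p => (mem_argmin_objective_iff hM.γ_pos).2 (h p)⟩

end

/-! ### Dynamics of the state variables -/

section Dynamics

variable (M : Model Ω) (v : ℕ → Ω → ℝ) {n : ℕ} (x q S A : ℝ)

theorem inventory_self : M.inventory v n q n = fun _ => q := by
  funext ω
  simp [inventory]

theorem price_self : M.price v n q S n = fun _ => S := by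
  funext ω
  simp [price, inventory_self]

/-- The quotient `n / n` is `1` for `n ≥ 1`; for `n = 0` it is `0`, which removes the dependence on
`A`. -/
theorem average_self : M.average v n q S A n = fun _ => (n : ℝ) / n * A := by
  funext ω
  simp [average]

theorem cash_self : M.cash v n x q S n = fun _ => x := by
  funext ω
  simp [cash]

variable {k : ℕ} (hk : n ≤ k) (ω : Ω)
include hk

theorem inventory_succ :
    M.inventory v n q (k + 1) ω = M.inventory v n q k ω - v k ω * M.δt := by
  simp only [inventory, Finset.sum_Ico_succ_top hk]
  ring

theorem price_succ :
    M.price v n q S (k + 1) ω = M.price v n q S k ω + M.σ * √M.δt * M.ε (k + 1) ω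
      + (M.G (M.inventory v n q (k + 1) ω) - M.G (M.inventory v n q k ω)) := by
  simp only [price, Finset.sum_Ico_succ_top hk]
  ring

theorem average_succ :
    M.average v n q S A (k + 1) ω
      = (k : ℝ) / (k + 1) * M.average v n q S A k ω
        + 1 / ((k : ℝ) + 1) * M.price v n q S (k + 1) ω := by
  have hk1 : (k : ℝ) + 1 ≠ 0 := by positivity
  simp only [average, Finset.sum_Ico_succ_top hk]
  push_cast
  rcases Nat.eq_zero_or_pos k with rfl | hk0
  · obtain rfl : n = 0 := by omega
    simp
  · have : (k : ℝ) ≠ 0 := by positivity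
    field_simp
    ring

/-- Since `A_{k+1}` gives weight `1 / (k + 1)` to `S_{k+1}`, the new spread is `k / (k + 1)` times
`S_{k+1} - A_k`, in which price and average enter only through their difference. -/
theorem spread_succ (hm : M.σ * √M.δt ≠ 0) :
    M.spread v n q S A (k + 1) ω
      = M.nextSpread k (M.inventory v n q k ω) (M.spread v n q S A k ω) (v k ω)
          (M.ε (k + 1) ω) := by
  have hk1 : (k : ℝ) + 1 ≠ 0 := by positivity
  simp only [spread, nextSpread, average_succ M v q S A hk, price_succ M v q S hk,
    inventory_succ M v q hk]
  generalize M.σ * √M.δt = m at *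
  field_simp
  ring

end Dynamics

/-- The wealth of the bank, up to the cost of delivering. -/
def gain (M : Model Ω) (v : ℕ → Ω → ℝ) (n : ℕ) (x q S A : ℝ) (k : ℕ) (ω : Ω) : ℝ :=
  M.Q * M.average v n q S A k ω - M.cash v n x q S k ω
    - M.inventory v n q k ω * M.price v n q S k ω + M.F (M.inventory v n q k ω)

theorem wealth_eq (M : Model Ω) (v : ℕ → Ω → ℝ) (n : ℕ) (x q S A : ℝ) (k : ℕ) (ω : Ω) :
    M.wealth v n x q S A k ω
      = M.gain v n x q S A k ω - M.deliveryCost (M.inventory v n q k ω) := by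
  simp only [wealth, gain, deliveryCost]
  ring

/-- In `X + q S - F(q)` the traded amount `v S_{k+1} δt` cancels, and so do the increment of `F` and
`q` times that of `G`. Permanent impact survives only through the term `Q A`. -/
theorem gain_succ (M : Model Ω) (v : ℕ → Ω → ℝ) {n : ℕ} (x q S A : ℝ) {k : ℕ} (hk : n ≤ k)
    (ω : Ω) (hm : M.σ * √M.δt ≠ 0) :
    M.gain v n x q S A (k + 1) ω = M.gain v n x q S A k ω
      - M.runningCost (M.volumes ω) k (M.inventory v n q k ω) (M.spread v n q S A k ω) (v k ω)
          (M.ε (k + 1) ω) (M.ε' (k + 1) ω) := by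
  have hk1 : (k : ℝ) + 1 ≠ 0 := by positivity
  have hZ : M.σ * √M.δt * M.spread v n q S A k ω
      = M.price v n q S k ω - M.average v n q S A k ω := by
    rw [spread, mul_div_cancel₀ _ hm]
  have hcash : M.cash v n x q S (k + 1) ω = M.cash v n x q S k ω
      + (v k ω * M.price v n q S (k + 1) ω * M.δt
      - M.inventory v n q k ω
          * (M.G (M.inventory v n q (k + 1) ω) - M.G (M.inventory v n q k ω))
      + (M.F (M.inventory v n q (k + 1) ω) - M.F (M.inventory v n q k ω))
      + M.L (v k ω / M.V (k + 1) ω) * M.V (k + 1) ω * M.δt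
      - M.σ * v k ω * M.δt ^ (3 / 2 : ℝ) / √3 * M.ε' (k + 1) ω) := by
    simp only [cash, Finset.sum_Ico_succ_top hk]
    ring
  have havg : M.average v n q S A (k + 1) ω = M.average v n q S A k ω
      + 1 / ((k : ℝ) + 1) * (M.price v n q S (k + 1) ω - M.average v n q S A k ω) := by
    rw [average_succ M v q S A hk]
    field_simp
    ring
  have hrisk : M.σ * √M.δt * ((M.inventory v n q k ω - M.Q / (k + 1)) * M.ε (k + 1) ω
        - M.Q / (k + 1) * M.spread v n q S A k ω)
      = M.σ * √M.δt * (M.inventory v n q k ω - M.Q / (k + 1)) * M.ε (k + 1) ω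
        - M.Q / (k + 1) * (M.price v n q S k ω - M.average v n q S A k ω) := by
    rw [← hZ]
    ring
  simp only [gain, runningCost, riskCost, volumes]
  rw [hrisk, hcash, havg, price_succ M v q S hk, inventory_succ M v q hk]
  field_simp
  ring

/-! ### Volumes as part of the state, adaptedness, and the verification argument -/

section Verification

variable [mΩ : MeasurableSpace Ω] {M : Model Ω} {P : Measure Ω} {ℱ : Filtration ℕ mΩ}

/-- The path of market volumes, as a positive path. -/
def Standing.vol (hM : M.Standing ℱ P) (ω : Ω) : M.Vol :=
  -- The default `1` makes every coordinate `ℱ 0`-measurable, since nothing is assumed about `V`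
  -- outside `1, …, N`.
  ⟨fun k => if 1 ≤ k ∧ k ≤ M.N then M.V k ω else 1, fun k h₁ h₂ => by
    simpa [h₁, h₂] using hM.V_pos k h₁ h₂ ω⟩

theorem Standing.vol_apply (hM : M.Standing ℱ P) (ω : Ω) {k : ℕ} (h₁ : 1 ≤ k) (h₂ : k ≤ M.N) :
    (hM.vol ω).1 k = M.volumes ω k := by
  simp [vol, volumes, h₁, h₂]

theorem Standing.measurable_vol (hM : M.Standing ℱ P) : Measurable[ℱ 0] hM.vol := by
  refine Measurable.subtype_mk (@measurable_pi_lambda _ _ _ (ℱ 0) _ _ fun k => ?_)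
  by_cases h : 1 ≤ k ∧ k ≤ M.N
  · simpa [h] using hM.V_measurable k h.1 h.2
  · simp [h]

theorem stepFunctional_congr {w w' : ℕ → ℝ} {n : ℕ} (h : w (n + 1) = w' (n + 1))
    (θ : ℝ → ℝ → EReal) : M.stepFunctional P w n θ = M.stepFunctional P w' n θ := by
  funext q Z v
  simp only [stepFunctional, h]

theorem objective_congr_of_theta {w w' : ℕ → ℝ} {n : ℕ} (h : w (n + 1) = w' (n + 1))
    (hθ : M.theta P w (n + 1) = M.theta P w' (n + 1)) :
    M.objective P w n = M.objective P w' n := by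
  funext q Z v
  rw [objective, objective, hθ, stepFunctional_congr h]

/-- Allows the actual volumes to be replaced by the measurable path `vol`. -/
theorem theta_congr {w w' : ℕ → ℝ} (h : ∀ k, 1 ≤ k → k ≤ M.N → w k = w' k) {n : ℕ}
    (hn : n ≤ M.N) : M.theta P w n = M.theta P w' n := by
  induction hn using Nat.decreasingInduction with
  | self =>
    funext q Z
    rw [theta_terminal, theta_terminal]
  | of_succ n hn ih =>
    have hobj := objective_congr_of_theta (h (n + 1) (by omega) (by omega)) ih
    funext q Z
    by_cases hd : n ∈ M.deliveryDates
    · rw [theta_of_mem _ _ _ hn hd, theta_of_mem _ _ _ hn hd, thetaTilde, thetaTilde, hobj]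
    · rw [theta_of_notMem _ _ _ hn hd, theta_of_notMem _ _ _ hn hd, thetaTilde, thetaTilde, hobj]

theorem objective_congr {w w' : ℕ → ℝ} (h : ∀ k, 1 ≤ k → k ≤ M.N → w k = w' k) {n : ℕ}
    (hn : n < M.N) : M.objective P w n = M.objective P w' n :=
  objective_congr_of_theta (h (n + 1) (by omega) (by omega)) (theta_congr h hn)

theorem Standing.objective_vol (hM : M.Standing ℱ P) (ω : Ω) {n : ℕ} (hn : n < M.N) :
    M.objective P (M.volumes ω) n = M.objective P (hM.vol ω).1 n :=
  objective_congr (fun _ h₁ h₂ => (hM.vol_apply ω h₁ h₂).symm) hn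

theorem Standing.thetaTilde_vol (hM : M.Standing ℱ P) (ω : Ω) {n : ℕ} (hn : n < M.N)
    (q Z : ℝ) : M.thetaTilde P (M.volumes ω) n q Z = M.thetaTilde P (hM.vol ω).1 n q Z := by
  rw [thetaTilde, thetaTilde, hM.objective_vol ω hn]

theorem Standing.vol_scale_ne_zero (hM : M.Standing ℱ P) : M.σ * √M.δt ≠ 0 :=
  (mul_pos hM.σ_pos (Real.sqrt_pos.2 hM.δt_pos)).ne'

/-- The state on which the decision at time `k` depends. -/
def Standing.state (hM : M.Standing ℱ P) (v : ℕ → Ω → ℝ) (n : ℕ) (q S A : ℝ) (k : ℕ) (ω : Ω) :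
    M.Vol × ℝ × ℝ :=
  (hM.vol ω, M.inventory v n q k ω, M.spread v n q S A k ω)

theorem Standing.gain_succ_vol (hM : M.Standing ℱ P) (v : ℕ → Ω → ℝ) {n : ℕ} (x q S A : ℝ)
    {k : ℕ} (hnk : n ≤ k) (hk : k < M.N) (ω : Ω) :
    M.gain v n x q S A (k + 1) ω = M.gain v n x q S A k ω
      - M.runningCost (hM.state v n q S A k ω).1 k (hM.state v n q S A k ω).2.1
          (hM.state v n q S A k ω).2.2 (v k ω) (M.ε (k + 1) ω) (M.ε' (k + 1) ω) := by
  rw [gain_succ M v x q S A hnk ω hM.vol_scale_ne_zero]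
  simp only [runningCost, state, hM.vol_apply ω (k := k + 1) (by omega) (by omega)]

section Adapted

variable {v : ℕ → Ω → ℝ} {n m : ℕ} (hv : ∀ k, n ≤ k → k < m → Measurable[ℱ k] (v k))
  (hm : m ≤ M.N) {k : ℕ} (hk : k ≤ m)
include hv hk

theorem measurable_inventory (q : ℝ) : Measurable[ℱ k] (M.inventory v n q k) := by
  refine measurable_const.sub (Finset.measurable_fun_sum _ fun j hj => ?_)
  rw [Finset.mem_Ico] at hj
  exact ((hv j hj.1 (by omega)).mono (ℱ.mono hj.2.le) le_rfl).mul_const _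

include hm

theorem Standing.measurable_price (hM : M.Standing ℱ P) (q S : ℝ) :
    Measurable[ℱ k] (M.price v n q S k) := by
  refine (measurable_const.add ((hM.continuous_G.measurable.comp
    (measurable_inventory hv hk q)).sub measurable_const)).add
    ((Finset.measurable_fun_sum _ fun j hj => ?_).const_mul _)
  rw [Finset.mem_Ico] at hj
  exact (hM.ε_measurable (j + 1) (by omega) (by omega)).mono (ℱ.mono (by omega)) le_rfl

theorem Standing.measurable_average (hM : M.Standing ℱ P) (q S A : ℝ) :
    Measurable[ℱ k] (M.average v n q S A k) := by
  refine measurable_const.add ((Finset.measurable_fun_sum _ fun j hj => ?_).const_mul _)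
  rw [Finset.mem_Ico] at hj
  exact (hM.measurable_price hv hm (by omega) q S).mono (ℱ.mono (by omega)) le_rfl

theorem Standing.measurable_state (hM : M.Standing ℱ P) (q S A : ℝ) :
    Measurable[ℱ k] (hM.state v n q S A k) :=
  (hM.measurable_vol.mono (ℱ.mono (Nat.zero_le _)) le_rfl).prodMk
    ((measurable_inventory hv hk q).prodMk
      (((hM.measurable_price hv hm hk q S).sub
        (hM.measurable_average hv hm hk q S A)).div_const _))

/-- Induction along the recursion, from which `F` has disappeared, so that measurability of `F` is
never needed. -/
theorem Standing.measurable_gain (hM : M.Standing ℱ P) (x q S A : ℝ) (hnk : n ≤ k) :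
    Measurable[ℱ k] (M.gain v n x q S A k) := by
  induction k, hnk using Nat.le_induction with
  | base =>
    unfold gain
    simp only [inventory_self, price_self, average_self, cash_self]
    exact measurable_const
  | succ k hnk ih =>
    have hle : ℱ k ≤ ℱ (k + 1) := ℱ.mono (Nat.le_succ k)
    have hkN : k < M.N := by omega
    rw [show M.gain v n x q S A (k + 1) = _ from
      funext (hM.gain_succ_vol v x q S A hnk hkN)]
    have hstate : Measurable[ℱ (k + 1)] fun ω => (hM.state v n q S A k ω, v k ω) :=
      ((hM.measurable_state hv hm (by omega) q S A).mono hle le_rfl).prodMk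
        ((hv k hnk (by omega)).mono hle le_rfl)
    have hinn : Measurable[ℱ (k + 1)] fun ω => (M.ε (k + 1) ω, M.ε' (k + 1) ω) :=
      (hM.ε_measurable (k + 1) (by omega) (by omega)).prodMk
        (hM.ε'_measurable (k + 1) (by omega) (by omega))
    have hgain : Measurable[ℱ (k + 1)] (M.gain v n x q S A k) :=
      (ih (by omega)).mono hle le_rfl
    have hcost := (hM.continuous_runningCost hkN).measurable.comp (hstate.prodMk hinn)
    exact hgain.sub hcost

end Adapted

/-- `exp(-γ B_k)`, where `B_k` is the wealth up to the cost of delivering. -/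
def expGain (M : Model Ω) (v : ℕ → Ω → ℝ) (n : ℕ) (x q S A : ℝ) (k : ℕ) (ω : Ω) : ℝ≥0∞ :=
  ENNReal.ofReal (Real.exp (-M.γ * M.gain v n x q S A k ω))

omit mΩ in
theorem exp_wealth_eq (v : ℕ → Ω → ℝ) (n : ℕ) (x q S A : ℝ) (k : ℕ) (ω : Ω) :
    ENNReal.ofReal (Real.exp (-M.γ * M.wealth v n x q S A k ω))
      = M.expGain v n x q S A k ω * M.expScale (M.deliveryCost (M.inventory v n q k ω)) := by
  rw [expScale_coe, expGain, ← ENNReal.ofReal_mul (Real.exp_pos _).le, ← Real.exp_add,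
    wealth_eq]
  congr 2
  ring

/-- The loss of gain over the day becomes the running-cost factor of `expCost`, and the updated
state becomes the argument of its continuation factor. -/
theorem Standing.expGain_succ_mul (hM : M.Standing ℱ P) (v : ℕ → Ω → ℝ) {n : ℕ} (x q S A : ℝ)
    {k : ℕ} (hnk : n ≤ k) (hk : k < M.N) (ω : Ω) :
    M.expGain v n x q S A (k + 1) ω * M.expTheta P (k + 1) (hM.state v n q S A (k + 1) ω)
      = M.expGain v n x q S A k ω * M.expCost P k
          ((hM.state v n q S A k ω, v k ω), (M.ε (k + 1) ω, M.ε' (k + 1) ω)) := by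
  simp only [expCost, state, expGain]
  rw [← mul_assoc, ← ENNReal.ofReal_mul (Real.exp_pos _).le, ← Real.exp_add,
    hM.gain_succ_vol v x q S A hnk hk, state,
    spread_succ M v q S A hnk ω hM.vol_scale_ne_zero, inventory_succ M v q hnk]
  congr 3
  ring

variable {n : ℕ} {s : Strategy Ω}

theorem measurableSet_le_of_admissible (hs : s ∈ M.admissible ℱ n) (k : ℕ) :
    MeasurableSet[ℱ k] {ω | s.2 ω ≤ k} := by
  simpa using hs.2.1 k

theorem measurableSet_gt_of_admissible (hs : s ∈ M.admissible ℱ n) (k : ℕ) :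
    MeasurableSet[ℱ k] {ω | k < s.2 ω} := by
  convert (measurableSet_le_of_admissible hs k).compl using 1
  ext ω
  simp

theorem measurableSet_eq_of_admissible (hs : s ∈ M.admissible ℱ n) (k : ℕ) :
    MeasurableSet[ℱ k] {ω | s.2 ω = k} := by
  convert hs.2.1.measurableSet_eq k using 1
  ext ω
  simp

/-- Expected cost of following a strategy up to time `k`, and of behaving optimally from then
on. -/
def Standing.stagedCost (hM : M.Standing ℱ P) (n : ℕ) (x q S A : ℝ) (s : Strategy Ω) (k : ℕ) :
    ℝ≥0∞ :=
  ∫⁻ ω in {ω | s.2 ω < k},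
      ENNReal.ofReal (Real.exp (-M.γ * M.wealth s.1 n x q S A (s.2 ω) ω)) ∂P
    + ∫⁻ ω in {ω | k ≤ s.2 ω},
      M.expGain s.1 n x q S A k ω * M.expTheta P k (hM.state s.1 n q S A k ω) ∂P

theorem Standing.stagedCost_terminal (hM : M.Standing ℱ P) (hs : s ∈ M.admissible ℱ n)
    (x q S A : ℝ) :
    hM.stagedCost n x q S A s M.N
      = ∫⁻ ω, ENNReal.ofReal (Real.exp (-M.γ * M.wealth s.1 n x q S A (s.2 ω) ω)) ∂P := by
  have hset : MeasurableSet {ω | M.N ≤ s.2 ω} := by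
    have h := ℱ.le _ _ (measurableSet_le_of_admissible hs (M.N - 1)).compl
    convert h using 1
    ext ω
    rcases Nat.eq_zero_or_pos M.N with h0 | h0
    · obtain ⟨d, hd⟩ := hM.dates_nonempty
      have := hM.dates_mem d hd
      omega
    · simp only [Set.mem_ofPred_eq, Set.mem_compl_iff]
      omega
  have hcompl : {ω | s.2 ω < M.N} = {ω | M.N ≤ s.2 ω}ᶜ := by
    ext ω
    simp
  rw [stagedCost, hcompl, add_comm]
  refine Eq.trans ?_ (lintegral_add_compl _ hset)
  congr 1
  refine setLIntegral_congr_fun hset fun ω hω => ?_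
  -- All optional delivery dates are strictly before `N`.
  have : s.2 ω = M.N := by
    rcases (hs.2.2 ω).2 with h | h
    · have := hM.dates_mem _ h
      have : M.N ≤ s.2 ω := hω
      omega
    · exact h
  rw [this, exp_wealth_eq, expTheta_terminal]
  rfl

/-- The point is that the right-hand side does not involve the strategy `s`. -/
theorem Standing.stagedCost_initial (hM : M.Standing ℱ P) (hs : s ∈ M.admissible ℱ n)
    (x q S A : ℝ) :
    hM.stagedCost n x q S A s n
      = ∫⁻ ω, ENNReal.ofReal (Real.exp (-M.γ * (M.Q * ((n : ℝ) / n * A) - x - q * S + M.F q)))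
          * M.expTheta P n (hM.vol ω, q, (S - (n : ℝ) / n * A) / (M.σ * √M.δt)) ∂P := by
  have h₁ : {ω | s.2 ω < n} = ∅ := by
    ext ω
    simpa using (hs.2.2 ω).1
  have h₂ : {ω | n ≤ s.2 ω} = Set.univ := by
    ext ω
    simpa using (hs.2.2 ω).1
  simp only [stagedCost, h₁, h₂, Measure.restrict_empty, lintegral_zero_measure, zero_add,
    Measure.restrict_univ, expGain, gain, state, spread, inventory_self, price_self,
    average_self, cash_self]

theorem Standing.stagedCost_split (hM : M.Standing ℱ P) (hs : s ∈ M.admissible ℱ n)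
    (x q S A : ℝ) (k : ℕ) :
    hM.stagedCost n x q S A s k
      = ∫⁻ ω in {ω | s.2 ω < k},
          ENNReal.ofReal (Real.exp (-M.γ * M.wealth s.1 n x q S A (s.2 ω) ω)) ∂P
        + ∫⁻ ω in {ω | s.2 ω = k},
          M.expGain s.1 n x q S A k ω * M.expTheta P k (hM.state s.1 n q S A k ω) ∂P
        + ∫⁻ ω in {ω | k < s.2 ω},
          M.expGain s.1 n x q S A k ω * M.expTheta P k (hM.state s.1 n q S A k ω) ∂P := by
  have hset : MeasurableSet {ω | k < s.2 ω} :=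
    ℱ.le k _ (measurableSet_gt_of_admissible hs k)
  have hunion : {ω | k ≤ s.2 ω} = {ω | s.2 ω = k} ∪ {ω | k < s.2 ω} := by
    ext ω
    simp only [Set.mem_ofPred_eq, Set.mem_union]
    omega
  have hdisj : Disjoint {ω | s.2 ω = k} {ω | k < s.2 ω} :=
    Set.disjoint_left.2 fun ω (h : s.2 ω = k) (h' : k < s.2 ω) => by omega
  rw [stagedCost, hunion, lintegral_union hset hdisj, add_assoc]

/-- Given `ℱ k`, the innovations of the next day can be integrated out on `{k < n⋆}`, which turns
the continuation value into the one-step objective; on `{n⋆ = k}` the delivery cost is paid. -/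
theorem Standing.stagedCost_succ [IsProbabilityMeasure P] (hM : M.Standing ℱ P)
    (hs : s ∈ M.admissible ℱ n) (x q S A : ℝ) {k : ℕ} (hnk : n ≤ k) (hk : k < M.N) :
    hM.stagedCost n x q S A s (k + 1)
      = ∫⁻ ω in {ω | s.2 ω < k},
          ENNReal.ofReal (Real.exp (-M.γ * M.wealth s.1 n x q S A (s.2 ω) ω)) ∂P
        + ∫⁻ ω in {ω | s.2 ω = k}, M.expGain s.1 n x q S A k ω
            * M.expScale (M.deliveryCost (M.inventory s.1 n q k ω)) ∂P
        + ∫⁻ ω in {ω | k < s.2 ω}, M.expGain s.1 n x q S A k ω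
            * M.expObjective P k (hM.state s.1 n q S A k ω) (s.1 k ω) ∂P := by
  have hsk : MeasurableSet {ω | s.2 ω = k} := ℱ.le k _ (measurableSet_eq_of_admissible hs k)
  have hgt := measurableSet_gt_of_admissible hs k
  have h₁ : {ω | s.2 ω < k + 1} = {ω | s.2 ω < k} ∪ {ω | s.2 ω = k} := by
    ext ω
    simp only [Set.mem_ofPred_eq, Set.mem_union]
    omega
  have hdisj : Disjoint {ω | s.2 ω < k} {ω | s.2 ω = k} :=
    Set.disjoint_left.2 fun ω (h : s.2 ω < k) (h' : s.2 ω = k) => by omega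
  rw [stagedCost, h₁, lintegral_union hsk hdisj]
  congr 1
  · congr 1
    refine setLIntegral_congr_fun hsk fun ω (hω : s.2 ω = k) => ?_
    rw [hω, exp_wealth_eq]
  -- The event `{k < n⋆}` is known at time `k`, so its indicator is absorbed into the frozen weight.
  · have hΦ : Measurable[ℱ k] ({ω | k < s.2 ω}.indicator (M.expGain s.1 n x q S A k)) :=
      Measurable.indicator (ENNReal.measurable_ofReal.comp (Real.measurable_exp.comp
        ((hM.measurable_gain hs.1 le_rfl hk.le x q S A hnk).const_mul _))) hgt
    have hY : Measurable[ℱ k] fun ω => (hM.state s.1 n q S A k ω, s.1 k ω) :=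
      (hM.measurable_state hs.1 le_rfl hk.le q S A).prodMk (hs.1 k hnk hk)
    have hfreeze := lintegral_freeze (ℱ.le k) hY (hM.measurable_innovations hk)
      (hM.indep k hk) hΦ (hM.measurable_expCost hk)
    have hind : ∀ g : Ω → ℝ≥0∞,
        ∫⁻ ω in {ω | k < s.2 ω}, M.expGain s.1 n x q S A k ω * g ω ∂P
          = ∫⁻ ω, {ω | k < s.2 ω}.indicator (M.expGain s.1 n x q S A k) ω * g ω ∂P := by
      intro g
      rw [← lintegral_indicator (ℱ.le k _ hgt)]
      refine lintegral_congr fun ω => ?_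
      rw [Set.indicator_mul_left]
    simp_rw [hM.expGain_succ_mul s.1 x q S A hnk hk, expObjective_eq_lintegral hM.γ_pos]
    rw [hind, ← hfreeze]
    exact hind _

theorem Standing.expTheta_le_deliveryCost (hM : M.Standing ℱ P) (hs : s ∈ M.admissible ℱ n)
    {k : ℕ} (hk : k < M.N) {ω : Ω} (hω : s.2 ω = k) (p : M.Vol × ℝ × ℝ) :
    M.expTheta P k p ≤ M.expScale (M.deliveryCost p.2.1) := by
  have hd : k ∈ M.deliveryDates := by
    rcases (hs.2.2 ω).2 with h | h
    · exact hω ▸ h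
    · omega
  rw [expTheta_of_mem hM.γ_pos hk hd]
  exact min_le_right _ _

theorem expTheta_le_expObjective (hγ : 0 < M.γ) {k : ℕ} (hk : k < M.N) (p : M.Vol × ℝ × ℝ)
    (v : ℝ) : M.expTheta P k p ≤ M.expObjective P k p v := by
  by_cases h : k ∈ M.deliveryDates
  · rw [expTheta_of_mem hγ hk h]
    exact (min_le_left _ _).trans (iInf_le _ v)
  · rw [expTheta_of_notMem hγ hk h]
    exact iInf_le _ v

variable [IsProbabilityMeasure P]

/-- Bellman's inequality: `θ_k` is at most the cost of either decision available at time `k`. -/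
theorem Standing.stagedCost_le_succ (hM : M.Standing ℱ P)
    (hs : s ∈ M.admissible ℱ n) (x q S A : ℝ) {k : ℕ} (hnk : n ≤ k) (hk : k < M.N) :
    hM.stagedCost n x q S A s k ≤ hM.stagedCost n x q S A s (k + 1) := by
  rw [hM.stagedCost_split hs x q S A k, hM.stagedCost_succ hs x q S A hnk hk]
  have hsk := measurableSet_eq_of_admissible hs k
  have hgt := (measurableSet_gt_of_admissible hs k)
  refine add_le_add (add_le_add le_rfl ?_) ?_
  · refine setLIntegral_mono' (ℱ.le k _ hsk) fun ω (hω : s.2 ω = k) => ?_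
    exact mul_le_mul_right (hM.expTheta_le_deliveryCost hs hk hω _) _
  · refine setLIntegral_mono' (ℱ.le k _ hgt) fun ω _ => ?_
    exact mul_le_mul_right (expTheta_le_expObjective hM.γ_pos hk _ _) _

/-- The decision taken at time `k` is optimal, given the state. -/
def Standing.DecidesOptimally (hM : M.Standing ℱ P) (n : ℕ) (q S A : ℝ) (s : Strategy Ω) (k : ℕ)
    (ω : Ω) : Prop :=
  (s.2 ω = k → M.expScale (M.deliveryCost (M.inventory s.1 n q k ω))
    ≤ M.expTheta P k (hM.state s.1 n q S A k ω)) ∧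
  (k < s.2 ω → M.expObjective P k (hM.state s.1 n q S A k ω) (s.1 k ω)
    ≤ M.expTheta P k (hM.state s.1 n q S A k ω))

theorem Standing.stagedCost_succ_le (hM : M.Standing ℱ P)
    (hs : s ∈ M.admissible ℱ n) (x q S A : ℝ) {k : ℕ} (hnk : n ≤ k) (hk : k < M.N)
    (hopt : ∀ᵐ ω ∂P, hM.DecidesOptimally n q S A s k ω) :
    hM.stagedCost n x q S A s (k + 1) ≤ hM.stagedCost n x q S A s k := by
  rw [hM.stagedCost_split hs x q S A k, hM.stagedCost_succ hs x q S A hnk hk]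
  have hsk := measurableSet_eq_of_admissible hs k
  have hgt := measurableSet_gt_of_admissible hs k
  refine add_le_add (add_le_add le_rfl ?_) ?_
  · refine setLIntegral_mono_ae' (ℱ.le k _ hsk) (hopt.mono fun ω h hω => ?_)
    exact mul_le_mul_right (h.1 hω) _
  · refine setLIntegral_mono_ae' (ℱ.le k _ hgt) (hopt.mono fun ω h hω => ?_)
    exact mul_le_mul_right (h.2 hω) _

theorem Standing.isOptimal_of_decidesOptimally (hM : M.Standing ℱ P) (hn : n ≤ M.N)
    (hs : s ∈ M.admissible ℱ n) (x q S A : ℝ)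
    (hopt : ∀ k, n ≤ k → k < M.N → ∀ᵐ ω ∂P, hM.DecidesOptimally n q S A s k ω) :
    M.IsOptimal ℱ P n x q S A s := by
  have h₁ : ∀ s' ∈ M.admissible ℱ n, ∀ k, n ≤ k → k ≤ M.N →
      hM.stagedCost n x q S A s' n ≤ hM.stagedCost n x q S A s' k := by
    intro s' hs' k hnk
    induction k, hnk using Nat.le_induction with
    | base => exact fun _ => le_rfl
    | succ k hnk ih =>
      exact fun hk => (ih (by omega)).trans (hM.stagedCost_le_succ hs' x q S A hnk hk)
  have h₂ : ∀ k, n ≤ k → k ≤ M.N →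
      hM.stagedCost n x q S A s k ≤ hM.stagedCost n x q S A s n := by
    intro k hnk
    induction k, hnk using Nat.le_induction with
    | base => exact fun _ => le_rfl
    | succ k hnk ih =>
      exact fun hk => (hM.stagedCost_succ_le hs x q S A hnk hk (hopt k hnk hk)).trans
        (ih (by omega))
  refine ⟨hs, le_antisymm (le_iSup₂ (f := fun s _ => M.expectedUtility P n x q S A s) s hs)
    (iSup₂_le fun s' hs' => ?_)⟩
  rw [expectedUtility, expectedUtility, EReal.neg_le_neg_iff, EReal.coe_ennreal_le_coe_ennreal_iff,
    ← hM.stagedCost_terminal hs, ← hM.stagedCost_terminal hs']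
  calc _ ≤ hM.stagedCost n x q S A s n := h₂ _ hn le_rfl
    _ = hM.stagedCost n x q S A s' n := by
      rw [hM.stagedCost_initial hs, hM.stagedCost_initial hs']
    _ ≤ _ := h₁ s' hs' _ hn le_rfl

end Verification

variable [mΩ : MeasurableSpace Ω] {M : Model Ω} {P : Measure Ω} {ℱ : Filtration ℕ mΩ}

/-! ### The functional at inception -/

/-- At `n = 0` and `q = Q` the coefficient `q - Q / (n + 1)` of `ε` vanishes and the next spread is
`0`. The initial spread `Z`, which has no meaning at inception, only contributes a constant factor.
-/
theorem expObjective_zero [IsProbabilityMeasure P] (hM : M.Standing ℱ P) (hN : 0 < M.N)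
    (w : M.Vol) (Z v : ℝ) :
    M.expObjective P 0 (w, M.Q, Z) v
      = ENNReal.ofReal (Real.exp (-M.γ * (M.σ * √M.δt * M.Q * Z)))
        * M.expScale (M.priceFunctional P w.1 v) := by
  have hγ := hM.γ_pos
  have hδ : M.δt ^ (3 / 2 : ℝ) = M.δt * √M.δt := by
    rw [Real.sqrt_eq_rpow, ← Real.rpow_one_add' hM.δt_pos.le (by norm_num)]
    norm_num
  rw [priceFunctional, expScale_add hγ, expScale_add hγ, h, expScale_inv_gamma_log hγ,
    expScale_coe, expObjective_eq_lintegral hγ]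
  set r := -M.Q * (M.G (M.Q - v * M.δt) - M.G M.Q) + M.L (v / w.1 1) * w.1 1 * M.δt with hr
  have hpoint : ∀ ω, M.expCost P 0 (((w, M.Q, Z), v), (M.ε (0 + 1) ω, M.ε' (0 + 1) ω))
      = (ENNReal.ofReal (Real.exp (-M.γ * (M.σ * √M.δt * M.Q * Z)))
          * ENNReal.ofReal (Real.exp (M.γ * r))
          * M.expScale (M.theta P w.1 1 (M.Q - v * M.δt) 0))
        * ENNReal.ofReal
            (Real.exp (-M.γ * (v * M.δt / √3) * (M.σ * √M.δt * M.ε' 1 ω))) := by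
    intro ω
    have hrun : M.γ * M.runningCost w.1 0 M.Q Z v (M.ε (0 + 1) ω) (M.ε' (0 + 1) ω)
        = -M.γ * (M.σ * √M.δt * M.Q * Z) + M.γ * r
          + -M.γ * (v * M.δt / √3) * (M.σ * √M.δt * M.ε' 1 ω) := by
      simp only [runningCost, riskCost, hδ, hr, Nat.cast_zero, zero_add, div_one]
      ring
    have hspread : M.nextSpread 0 M.Q Z v (M.ε (0 + 1) ω) = 0 := by
      simp [nextSpread]
    simp only [expCost, expTheta]
    rw [hrun, hspread, Real.exp_add, Real.exp_add, ENNReal.ofReal_mul (by positivity),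
      ENNReal.ofReal_mul (by positivity)]
    ring
  simp_rw [hpoint]
  have hmeas : Measurable fun ω => ENNReal.ofReal
      (Real.exp (-M.γ * (v * M.δt / √3) * (M.σ * √M.δt * M.ε' 1 ω))) := by
    have := (hM.measurable_innovations hN).snd
    simp only [zero_add] at this
    fun_prop
  rw [lintegral_const_mul _ hmeas]
  ring

theorem mem_argmin_priceFunctional_iff [IsProbabilityMeasure P] (hM : M.Standing ℱ P)
    (hN : 0 < M.N) (w : M.Vol) (Z v : ℝ) :
    v ∈ argmin (M.priceFunctional P w.1) ↔ v ∈ argmin (M.objective P w.1 0 M.Q Z) := by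
  have hpos : ENNReal.ofReal (Real.exp (-M.γ * (M.σ * √M.δt * M.Q * Z))) ≠ 0 := by
    simpa using Real.exp_pos _
  rw [mem_argmin_objective_iff hM.γ_pos (p := (w, M.Q, Z)), le_iInf_iff]
  simp only [argmin, Set.mem_ofPred_eq, expObjective_zero hM hN,
    ENNReal.mul_le_mul_iff_right hpos ENNReal.ofReal_ne_top, expScale_le_iff hM.γ_pos]

theorem priceFunctional_congr {w w' : ℕ → ℝ} (h : ∀ k, 1 ≤ k → k ≤ M.N → w k = w' k)
    (hN : 1 ≤ M.N) : M.priceFunctional P w = M.priceFunctional P w' := by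
  funext v
  rw [priceFunctional, priceFunctional, theta_congr h hN, h 1 le_rfl hN]

theorem Standing.one_lt_N (hM : M.Standing ℱ P) : 1 < M.N := by
  obtain ⟨d, hd⟩ := hM.dates_nonempty
  have := hM.dates_mem d hd
  omega

theorem Standing.mem_argmin_initial_iff [IsProbabilityMeasure P] (hM : M.Standing ℱ P) (ω : Ω)
    (Z v : ℝ) : v ∈ argmin (M.priceFunctional P (M.volumes ω))
      ↔ v ∈ argmin (M.objective P (hM.vol ω).1 0 M.Q Z) := by
  have hN := hM.one_lt_N
  rw [priceFunctional_congr (fun _ h₁ h₂ => (hM.vol_apply ω h₁ h₂).symm) hN.le,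
    mem_argmin_priceFunctional_iff hM (by omega)]

/-! ### Following the rule is optimal -/

theorem Standing.decidesOptimally_of_rule (hM : M.Standing ℱ P) {n : ℕ} {q S A : ℝ}
    {s : Strategy Ω} {k : ℕ} (hk : k < M.N) {ω : Ω}
    (h : k ≤ s.2 ω →
      (k ∉ M.deliveryDates → k < s.2 ω ∧ s.1 k ω ∈ argmin (M.objective P (M.volumes ω) k
        (M.inventory s.1 n q k ω) (M.spread s.1 n q S A k ω))) ∧
      (k ∈ M.deliveryDates → M.thetaTilde P (M.volumes ω) k (M.inventory s.1 n q k ω)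
          (M.spread s.1 n q S A k ω) < (M.deliveryCost (M.inventory s.1 n q k ω) : EReal) →
        k < s.2 ω ∧ s.1 k ω ∈ argmin (M.objective P (M.volumes ω) k
          (M.inventory s.1 n q k ω) (M.spread s.1 n q S A k ω))) ∧
      (k ∈ M.deliveryDates → (M.deliveryCost (M.inventory s.1 n q k ω) : EReal)
          ≤ M.thetaTilde P (M.volumes ω) k (M.inventory s.1 n q k ω)
            (M.spread s.1 n q S A k ω) → s.2 ω = k)) :
    hM.DecidesOptimally n q S A s k ω := by
  have hγ := hM.γ_pos
  rw [hM.objective_vol ω hk, hM.thetaTilde_vol ω hk] at h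
  have hΘ := expScale_thetaTilde (P := P) hγ k (hM.state s.1 n q S A k ω)
  have harg := mem_argmin_objective_iff (P := P) hγ (n := k) (p := hM.state s.1 n q S A k ω)
    (v := s.1 k ω)
  constructor
  · intro hω
    obtain ⟨h₁, h₂, -⟩ := h hω.ge
    have hd : k ∈ M.deliveryDates := by
      by_contra hd
      -- The clauses of the rule that prescribe going on are incompatible with delivery at `k`.
      exact absurd (h₁ hd).1 (by omega)
    rw [expTheta_of_mem hγ hk hd]
    refine le_min ?_ le_rfl
    rw [← hΘ]
    refine (expScale_le_iff hγ).2 (not_lt.1 fun hlt => ?_)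
    exact absurd (h₂ hd hlt).1 (by omega)
  · intro hω
    obtain ⟨h₁, h₂, h₃⟩ := h hω.le
    by_cases hd : k ∈ M.deliveryDates
    · have hlt := not_le.1 fun hle => hω.ne' (h₃ hd hle)
      rw [expTheta_of_mem hγ hk hd]
      have hv := harg.1 (h₂ hd hlt).2
      refine le_min hv (hv.trans ?_)
      rw [← hΘ]
      exact (expScale_le_iff hγ).2 hlt.le
    · rw [expTheta_of_notMem hγ hk hd]
      exact harg.1 (h₁ hd).2

theorem Standing.isOptimal_of_followsRule [IsProbabilityMeasure P] (hM : M.Standing ℱ P) {n : ℕ}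
    (hn₀ : 1 ≤ n) (hn : n < M.N) {x q S A : ℝ} {s : Strategy Ω} (hs : s ∈ M.admissible ℱ n)
    (h : M.FollowsRule P n q S A s) : M.IsOptimal ℱ P n x q S A s :=
  hM.isOptimal_of_decidesOptimally hn.le hs x q S A fun k hnk hk =>
    h.mono fun _ hω => hM.decidesOptimally_of_rule hk (hω k (hn₀.trans hnk) hnk hk)

theorem Standing.isOptimal_of_followsRule_zero [IsProbabilityMeasure P] (hM : M.Standing ℱ P)
    {x S A : ℝ} {s : Strategy Ω} (hs : s ∈ M.admissible ℱ 0) (h₀ : M.FollowsInitialRule P s)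
    (h : M.FollowsRule P 0 M.Q S A s) : M.IsOptimal ℱ P 0 x M.Q S A s := by
  refine hM.isOptimal_of_decidesOptimally (Nat.zero_le _) hs x M.Q S A fun k hnk hk => ?_
  rcases Nat.eq_zero_or_pos k with rfl | hk0
  · have h0 : 0 ∉ M.deliveryDates := fun hd => by
      have := hM.dates_mem 0 hd
      omega
    refine h₀.mono fun ω hω => ⟨fun hs0 => ?_, fun _ => ?_⟩
    · rcases (hs.2.2 ω).2 with hd | hd
      · exact absurd (hs0 ▸ hd) h0
      · omega
    · rw [expTheta_of_notMem hM.γ_pos hk h0, ← mem_argmin_objective_iff hM.γ_pos]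
      simp only [state, inventory_self]
      exact (hM.mem_argmin_initial_iff ω _ _).1 hω
  · exact h.mono fun _ hω => hM.decidesOptimally_of_rule hk (hω k hk0 hnk hk)

/-! ### Existence of strategies following the rule -/

section Feedback

variable {v v' : ℕ → Ω → ℝ} {n k : ℕ}

omit mΩ in
theorem inventory_congr (h : ∀ j, n ≤ j → j < k → v j = v' j) (q : ℝ) :
    M.inventory v n q k = M.inventory v' n q k := by
  funext ω
  simp only [inventory]
  congr 1
  refine Finset.sum_congr rfl fun j hj => ?_
  rw [Finset.mem_Ico] at hj
  rw [h j hj.1 hj.2]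

omit mΩ in
theorem price_congr (h : ∀ j, n ≤ j → j < k → v j = v' j) (q S : ℝ) :
    M.price v n q S k = M.price v' n q S k := by
  funext ω
  simp only [price, inventory_congr h]

omit mΩ in
theorem spread_congr (h : ∀ j, n ≤ j → j < k → v j = v' j) (q S A : ℝ) :
    M.spread v n q S A k = M.spread v' n q S A k := by
  have havg : M.average v n q S A k = M.average v' n q S A k := by
    funext ω
    simp only [average]
    congr 2
    refine Finset.sum_congr rfl fun j hj => ?_
    rw [Finset.mem_Ico] at hj
    rw [price_congr (k := j + 1) (v' := v') fun i h₁ h₂ => h i h₁ (by omega)]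
  funext ω
  rw [spread, spread, havg, price_congr h]

end Feedback

/-- The state at time `k` depends only on orders before `k`, so the closed loop is built one date at
a time: modifying the order at `m` leaves all states up to `m` unchanged. -/
theorem Standing.exists_feedback (hM : M.Standing ℱ P) {n : ℕ} (q S A : ℝ)
    {φ : ℕ → M.Vol × ℝ × ℝ → ℝ} (hφ : ∀ k, k < M.N → Measurable (φ k)) (m : ℕ) (hnm : n ≤ m)
    (hm : m ≤ M.N) :
    ∃ v : ℕ → Ω → ℝ, ∀ k, n ≤ k → k < m →
      Measurable[ℱ k] (v k) ∧ ∀ ω, v k ω = φ k (hM.state v n q S A k ω) := by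
  induction m, hnm using Nat.le_induction with
  | base => exact ⟨fun _ _ => 0, fun k h₁ h₂ => by omega⟩
  | succ m hnm ih =>
    obtain ⟨v, hv⟩ := ih (by omega)
    have hstate : ∀ (g : Ω → ℝ) k, k ≤ m →
        hM.state (Function.update v m g) n q S A k = hM.state v n q S A k := by
      intro g k hk
      have hcongr : ∀ j, n ≤ j → j < k → Function.update v m g j = v j := fun j _ hj =>
        Function.update_of_ne (by omega) _ _
      funext ω
      rw [state, state, inventory_congr hcongr, spread_congr hcongr]
    refine ⟨Function.update v m fun ω => φ m (hM.state v n q S A m ω), fun k h₁ h₂ => ?_⟩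
    rw [hstate _ k (by omega)]
    rcases (Nat.lt_succ_iff.1 h₂).eq_or_lt with rfl | hlt
    · rw [Function.update_self]
      exact ⟨(hφ k (by omega)).comp (hM.measurable_state (fun j h h' => (hv j h h').1)
        (by omega) le_rfl q S A), fun _ => rfl⟩
    · rw [Function.update_of_ne hlt.ne]
      exact hv k h₁ hlt

/-- The set of states in which the rule prescribes to deliver at time `k`. -/
def deliverySet (M : Model Ω) (P : Measure Ω) (k : ℕ) : Set (M.Vol × ℝ × ℝ) :=
  {p | k ∈ M.deliveryDates ∧
    (M.deliveryCost p.2.1 : EReal) ≤ M.thetaTilde P p.1 k p.2.1 p.2.2}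

theorem Standing.measurableSet_deliverySet [IsProbabilityMeasure P] (hM : M.Standing ℱ P) {k : ℕ}
    (hk : k < M.N) : MeasurableSet (M.deliverySet P k) := by
  have h : M.deliverySet P k = {p | k ∈ M.deliveryDates ∧
      M.expScale (M.deliveryCost p.2.1) ≤ ⨅ v, M.expObjective P k p v} := by
    ext p
    simp only [deliverySet, Set.mem_ofPred_eq, ← expScale_thetaTilde hM.γ_pos,
      expScale_le_iff hM.γ_pos]
  rw [h]
  exact (MeasurableSet.const _).inter (measurableSet_le
    hM.continuous_expScale_deliveryCost.measurable (hM.measurable_iInf_expObjective hk))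

/-- Measurable selectors are fed back into the dynamics, and delivery takes place at the first
entrance of the state into `deliverySet`, or at `N` failing that. -/
theorem Standing.exists_strategy [IsProbabilityMeasure P] (hM : M.Standing ℱ P) {n : ℕ}
    (hn : n < M.N) (q S A : ℝ) :
    ∃ s ∈ M.admissible ℱ n, ∀ ω k, n ≤ k → k < M.N →
      s.1 k ω ∈ argmin (M.objective P (hM.vol ω).1 k (M.inventory s.1 n q k ω)
        (M.spread s.1 n q S A k ω)) ∧
      (k ≤ s.2 ω → (s.2 ω = k ↔ hM.state s.1 n q S A k ω ∈ M.deliverySet P k)) := by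
  classical
  have hsel : ∀ k, ∃ φ : M.Vol × ℝ × ℝ → ℝ, k < M.N → Measurable φ ∧
      ∀ p, φ p ∈ argmin (M.objective P p.1 k p.2.1 p.2.2) := fun k => by
    by_cases hk : k < M.N
    · obtain ⟨φ, hφ⟩ := hM.exists_selector hk
      exact ⟨φ, fun _ => hφ⟩
    · exact ⟨0, fun h => absurd h hk⟩
  choose φ hφ using hsel
  obtain ⟨v, hv⟩ := hM.exists_feedback q S A (fun k hk => (hφ k hk).1) M.N hn.le le_rfl
  have hex : ∀ ω, ∃ k, n ≤ k ∧
      (k = M.N ∨ k < M.N ∧ hM.state v n q S A k ω ∈ M.deliverySet P k) :=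
    fun ω => ⟨M.N, hn.le, Or.inl rfl⟩
  refine ⟨(v, fun ω => Nat.find (hex ω)), ⟨fun k h₁ h₂ => (hv k h₁ h₂).1, fun i => ?_,
    fun ω => ?_⟩, fun ω k h₁ h₂ => ⟨?_, fun hk => ?_⟩⟩
  · have hset : {ω | ((Nat.find (hex ω) : ℕ) : WithTop ℕ) ≤ i}
        = ⋃ k ∈ Set.Iic i, {ω | n ≤ k ∧
          (k = M.N ∨ k < M.N ∧ hM.state v n q S A k ω ∈ M.deliverySet P k)} := by
      ext ω
      simp only [Set.mem_ofPred_eq, Set.mem_iUnion, Set.mem_Iic, exists_prop]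
      rw [Nat.cast_le, Nat.find_le_iff]
    change MeasurableSet[ℱ i] {ω | ((Nat.find (hex ω) : ℕ) : WithTop ℕ) ≤ i}
    rw [hset]
    refine MeasurableSet.biUnion (Set.to_countable _) fun k (hk : k ≤ i) => ?_
    by_cases hkN : k < M.N
    · refine (MeasurableSet.const _).inter ((MeasurableSet.const _).union
        ((MeasurableSet.const _).inter ?_))
      exact ℱ.mono hk _ ((hM.measurable_state (fun j h h' => (hv j h h').1) le_rfl hkN.le
        q S A) (hM.measurableSet_deliverySet hkN))
    · simp only [hkN, false_and, or_false]
      exact MeasurableSet.const _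
  · obtain ⟨h₁, h₂⟩ := Nat.find_spec (hex ω)
    exact ⟨h₁, h₂.symm.imp (fun h => h.2.1) id⟩
  · dsimp only
    rw [(hv k h₁ h₂).2 ω]
    exact (hφ k h₂).2 (hM.state v n q S A k ω)
  · dsimp only at hk ⊢
    constructor
    · intro heq
      have hspec := (Nat.find_spec (hex ω)).2
      rw [heq] at hspec
      rcases hspec with h | h
      · omega
      · exact h.2
    · intro hmem
      exact le_antisymm (Nat.find_min' (hex ω) ⟨h₁, Or.inr ⟨h₂, hmem⟩⟩) hk

/-- `FollowsRule` only constrains dates `k ≥ 1`; the last conjunct, taken at `n = 0`, supplies the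
order at inception. -/
theorem Standing.exists_followsRule [IsProbabilityMeasure P] (hM : M.Standing ℱ P) {n : ℕ}
    (hn : n < M.N) (q S A : ℝ) :
    ∃ s ∈ M.admissible ℱ n, M.FollowsRule P n q S A s ∧
      ∀ ω, s.1 n ω ∈ argmin (M.objective P (hM.vol ω).1 n q
        ((S - (n : ℝ) / n * A) / (M.σ * √M.δt))) := by
  obtain ⟨s, hs, h⟩ := hM.exists_strategy hn q S A
  refine ⟨s, hs, ae_of_all _ fun ω k _ hnk hk hks => ?_, fun ω => ?_⟩
  · obtain ⟨harg, hdeliver⟩ := h ω k hnk hk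
    have hdeliver := hdeliver hks
    dsimp only
    rw [hM.objective_vol ω hk, hM.thetaTilde_vol ω hk]
    refine ⟨fun hd => ⟨?_, harg⟩, fun _ hlt => ⟨?_, harg⟩, fun hd hle => hdeliver.2 ⟨hd, hle⟩⟩
    · exact lt_of_le_of_ne hks fun he => hd (hdeliver.1 he.symm).1
    · exact lt_of_le_of_ne hks fun he => absurd (hdeliver.1 he.symm).2 (not_le.2 hlt)
  · have := (h ω n le_rfl hn).1
    simpa only [spread, inventory_self, price_self, average_self] using this

theorem Standing.argmin_objective_nonempty [IsProbabilityMeasure P] (hM : M.Standing ℱ P) {n : ℕ}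
    (hn : n < M.N) (w : M.Vol) (q Z : ℝ) : (argmin (M.objective P w.1 n q Z)).Nonempty := by
  obtain ⟨φ, -, hφ⟩ := hM.exists_selector hn
  exact ⟨_, hφ (w, q, Z)⟩

end

end Model

end ASR

theorem mainTheorem6 {Ω : Type*} [mΩ : MeasurableSpace Ω] (P : Measure Ω)
    [IsProbabilityMeasure P] (ℱ : Filtration ℕ mΩ) (M : ASR.Model Ω) (hM : M.Standing ℱ P) :
    -- the minimisers exist
    (∀ w : ℕ → ℝ, (∀ k, 1 ≤ k → k ≤ M.N → 0 < w k) →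
      (ASR.Model.argmin (M.priceFunctional P w)).Nonempty ∧
      ∀ n, 1 ≤ n → n < M.N → ∀ q Z : ℝ,
        (ASR.Model.argmin (M.objective P w n q Z)).Nonempty) ∧
    -- the problem at inception
    ((∃ s ∈ M.admissible ℱ 0,
        M.FollowsInitialRule P s ∧ M.FollowsRule P 0 M.Q M.S₀ 0 s) ∧
      ∀ s ∈ M.admissible ℱ 0,
        M.FollowsInitialRule P s → M.FollowsRule P 0 M.Q M.S₀ 0 s →
          M.IsOptimal ℱ P 0 0 M.Q M.S₀ 0 s) ∧
    -- the problem at an intermediate time, from any state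
    (∀ n, 1 ≤ n → n < M.N → ∀ x q S A : ℝ,
      (∃ s ∈ M.admissible ℱ n, M.FollowsRule P n q S A s) ∧
      ∀ s ∈ M.admissible ℱ n, M.FollowsRule P n q S A s → M.IsOptimal ℱ P n x q S A s) := by
  have hN : 0 < M.N := Nat.zero_lt_of_lt hM.one_lt_N
  refine ⟨fun w hw => ⟨?_, fun n _ hn q Z => hM.argmin_objective_nonempty hn ⟨w, hw⟩ q Z⟩,
    ⟨?_, fun s hs h₀ h => hM.isOptimal_of_followsRule_zero hs h₀ h⟩,
    fun n hn₀ hn x q S A => ⟨?_, fun s hs h => hM.isOptimal_of_followsRule hn₀ hn hs h⟩⟩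
  -- The spread `0` is an arbitrary choice: at date `0` the minimisers do not depend on it.
  · obtain ⟨v, hv⟩ := hM.argmin_objective_nonempty hN ⟨w, hw⟩ M.Q 0
    exact ⟨v, (ASR.Model.mem_argmin_priceFunctional_iff hM hN ⟨w, hw⟩ 0 v).2 hv⟩
  · obtain ⟨s, hs, h, h₀⟩ := hM.exists_followsRule hN M.Q M.S₀ 0
    exact ⟨s, hs, ae_of_all _ fun ω => (hM.mem_argmin_initial_iff ω _ _).2 (h₀ ω), h⟩
  · obtain ⟨s, hs, h, -⟩ := hM.exists_followsRule hn q S A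
    exact ⟨s, hs, h⟩
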